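/- **Setting.** Let $\sigma$ be a substitution in $\mathbb R^d$ ($d\ge 1$) on finitely many prototiles (tile types up to translation) $t_1,\dots,t_N$. Each prototile is a polytope: an interval, polygon or polyhedron, not necessarily convex, that is, a compact set which is the closure of its connected interior and whose boundary is a finite union of non-overlapping convex facets (edges if $d=2$). There is a stretching factor $\lambda>1$, and $\sigma$ prescribes for each $i$ a subdivision of $\lambda t_i$ into finitely many non-overlapping translates of prototiles. Then $\sigma$ acts on patches and tilings by stretching by $\lambda$ and subdividing. The $n$-supertile of type $i$ is the patch $\sigma^n(t_i)$, and the $n$-supertiles of a tiling $\sigma^n(S)$ are the patches obtained from the tiles of $S$. The tiling space $\Omega$ is the set of admissible tilings, i.e. tilings of $\mathbb R^d$ by translates of prototiles each of whose finite patches occurs, up to translation, in some supertile. In its topology two tilings are close if, up to small translations, they agree on a large ball around the origin. Assume that $\sigma$ is primitive (for some $n\ge1$ every $n$-supertile contains tiles of every type) and non-periodic (no tiling in $\Omega$ has a nonzero period), and that in admissible tilings tiles meet full facet to full facet. The substitution has *finite local complexity with respect to translations* if for each $R>0$ there are, up to translation, only finitely many patches of radius $R$ in tilings of $\Omega$. It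 *forces the border* if for some $k$ any two $k$-supertiles of the same type, in any admissible tilings, are surrounded by the same pattern of ordinary tiles (the tiles touching the supertile in at least one point). The (uncollared) *Anderson–Putnam complex* $\Gamma_{AP}$ is the quotient of the disjoint union of one copy of each closed prototile by the equivalence relation generated by identifying, by translation, a facet of $t_i$ with a facet of $t_j$ whenever these facets of tiles of types $i$ and $j$ coincide somewhere in an admissible tiling. **Theorem.** If $\sigma$ forces the border and has finite local complexity with respect to translations, then stretching each tile of $\Gamma_{AP}$ by $\lambda$, subdividing it by the substitution rule and sending each piece to the corresponding prototile gives a well-defined continuous map $\sigma:\Gamma_{AP}\to\Gamma_{AP}$, and $\Omega$ is homeomorphic to the inverse limit $$\Omega^0=\varprojlim(\Gamma_{AP},\sigma)=\{(x_0,x_1,\dots)\in\Gamma_{AP}^{\mathbb N} : \sigma(x_{n+1})=x_n\ \text{for all } n\ge 0\}.$$ -/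

import Mathlib

open Set

noncomputable section

namespace SubstitutionTiling

/-- Euclidean space `ℝ^d`. -/
abbrev Eu (d : ℕ) : Type := EuclideanSpace ℝ (Fin d)

/-- A polytopal tile in `ℝ^d` (an interval for `d = 1`, a polygon for `d = 2`, a polyhedron for
`d = 3`), not necessarily convex: a compact region, the closure of its connected interior, whose
boundary is the union of finitely many non-overlapping facets, each a convex polytope of
dimension `d - 1`. The facets (edges, if `d = 2`) are part of the data, so that an extra vertex may
be placed on a straight side, and a non-convex face of a polyhedron is listed as several facets. -/
structure PolytopalTile (d : ℕ) where
  carrier : Set (Eu d)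
  facets : Set (Set (Eu d))
  isCompact : IsCompact carrier
  closure_interior : closure (interior carrier) = carrier
  isConnected_interior : IsConnected (interior carrier)
  finite_facets : facets.Finite
  frontier_eq : frontier carrier = ⋃₀ facets
  facet_convex : ∀ F ∈ facets, ∃ s : Finset (Eu d),
    F = convexHull ℝ (s : Set (Eu d)) ∧
      Module.finrank ℝ (vectorSpan ℝ (s : Set (Eu d))) + 1 = d
  facets_nonoverlapping : ∀ F ∈ facets, ∀ G ∈ facets, F ≠ G →
    Disjoint (intrinsicInterior ℝ F) (intrinsicInterior ℝ G)

/-- A placed tile `(i, v)` is the prototile of type `i` translated by `v`. Sets of placed tiles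
serve as patches and as tilings; `translate v P` is `P + v`. -/
def translate {d : ℕ} {ι : Type*} (v : Eu d) (P : Set (ι × Eu d)) : Set (ι × Eu d) :=
  (fun p : ι × Eu d => (p.1, p.2 + v)) '' P

/-- A tiling substitution on tile types `ι`: each prototile `t_i`, stretched by the
factor `λ > 1`, is divided into non-overlapping translates of prototiles. -/
structure Substitution (d : ℕ) (ι : Type*) where
  tile : ι → PolytopalTile d
  factor : ℝ
  one_lt_factor : 1 < factor
  rule : ι → Finset (ι × Eu d)
  rule_cover : ∀ i, (⋃ p ∈ rule i, (fun x => x + p.2) '' (tile p.1).carrier) =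
    (fun x => factor • x) '' (tile i).carrier
  rule_nonoverlapping : ∀ i, ∀ p ∈ rule i, ∀ q ∈ rule i, p ≠ q →
    Disjoint (interior ((fun x => x + p.2) '' (tile p.1).carrier))
      (interior ((fun x => x + q.2) '' (tile q.1).carrier))

namespace Substitution

variable {d : ℕ} {ι : Type*} (σ : Substitution d ι)

/-- The region occupied by a placed tile. -/
def supp (p : ι × Eu d) : Set (Eu d) :=
  (fun x => x + p.2) '' (σ.tile p.1).carrier

/-- The facets of a placed tile. -/
def placedFacets (p : ι × Eu d) : Set (Set (Eu d)) :=
  (fun F : Set (Eu d) => (fun x => x + p.2) '' F) '' (σ.tile p.1).facets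

/-- The substitution acting on patches and tilings: each tile is stretched by `λ` about the origin
and subdivided. -/
def apply (P : Set (ι × Eu d)) : Set (ι × Eu d) :=
  {q | ∃ p ∈ P, ∃ r ∈ σ.rule p.1, q = (r.1, σ.factor • p.2 + r.2)}

/-- The `n`-supertile of type `i`, as a patch. -/
def supertile (n : ℕ) (i : ι) : Set (ι × Eu d) :=
  σ.apply^[n] {(i, 0)}

/-- `T` is a tiling of `ℝ^d`: the tiles cover and do not overlap. -/
def IsTiling (T : Set (ι × Eu d)) : Prop :=
  (⋃ p ∈ T, σ.supp p) = univ ∧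
    ∀ p ∈ T, ∀ q ∈ T, p ≠ q → Disjoint (interior (σ.supp p)) (interior (σ.supp q))

/-- `T` is an admissible tiling: every finite patch of `T` is, up to translation, found in some
supertile. -/
def Admissible (T : Set (ι × Eu d)) : Prop :=
  σ.IsTiling T ∧
    ∀ P ⊆ T, P.Finite → ∃ (n : ℕ) (i : ι) (v : Eu d), translate v P ⊆ σ.supertile n i

/-- The tiles of `T` that touch (meet in at least one point) the set `A`. -/
def touching (T : Set (ι × Eu d)) (A : Set (Eu d)) : Set (ι × Eu d) :=
  {p ∈ T | (σ.supp p ∩ A).Nonempty}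

/-- The tiling space `Ω` of the substitution. -/
def TilingSpace : Type _ := {T : Set (ι × Eu d) // σ.Admissible T}

/-- `T` and `T'` are `ε`-close: after translations by less than `ε` they have the same tiles
on the ball of radius `1/ε` around the origin. -/
def Close (ε : ℝ) (T T' : Set (ι × Eu d)) : Prop :=
  ∃ u v : Eu d, ‖u‖ < ε ∧ ‖v‖ < ε ∧
    σ.touching (translate u T) (Metric.closedBall 0 (1 / ε)) =
      σ.touching (translate v T') (Metric.closedBall 0 (1 / ε))

theorem Close.mono {σ : Substitution d ι} {ε δ : ℝ} (hε : 0 < ε) (h : ε ≤ δ)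
    {T T' : Set (ι × Eu d)} (hc : σ.Close ε T T') : σ.Close δ T T' := by
  obtain ⟨u, v, hu, hv, he⟩ := hc
  have hsub : Metric.closedBall (0 : Eu d) (1 / δ) ⊆ Metric.closedBall 0 (1 / ε) :=
    Metric.closedBall_subset_closedBall (one_div_le_one_div_of_le hε h)
  have key : ∀ S : Set (ι × Eu d), σ.touching S (Metric.closedBall 0 (1 / δ)) =
      {p ∈ σ.touching S (Metric.closedBall 0 (1 / ε)) |
        (σ.supp p ∩ Metric.closedBall 0 (1 / δ)).Nonempty} := by
    intro S
    ext p
    exact ⟨fun hp => ⟨⟨hp.1, hp.2.mono (inter_subset_inter_right _ hsub)⟩, hp.2⟩,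
      fun hp => ⟨hp.1.1, hp.2⟩⟩
  exact ⟨u, v, hu.trans_le h, hv.trans_le h, by rw [key, key, he]⟩

/-- The tiling topology: the `ε`-close tilings, `ε > 0`, form a neighborhood basis at `T`. (This is
the topology of the usual tiling metric `min 1 (inf {ε | T, T' are ε-close})`.) -/
instance : TopologicalSpace σ.TilingSpace where
  IsOpen U := ∀ T ∈ U, ∃ ε > 0, ∀ T' : σ.TilingSpace, σ.Close ε T.1 T'.1 → T' ∈ U
  isOpen_univ := fun _ _ => ⟨1, one_pos, fun _ _ => mem_univ _⟩
  isOpen_inter := by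
    intro U V hU hV T hT
    obtain ⟨a, ha, hA⟩ := hU T hT.1
    obtain ⟨b, hb, hB⟩ := hV T hT.2
    have hm : 0 < min a b := lt_min ha hb
    exact ⟨min a b, hm, fun T' h =>
      ⟨hA T' (h.mono hm (min_le_left a b)), hB T' (h.mono hm (min_le_right a b))⟩⟩
  isOpen_sUnion := by
    intro S hS T hT
    obtain ⟨U, hU, hTU⟩ := hT
    obtain ⟨ε, hε, h⟩ := hS U hU T hTU
    exact ⟨ε, hε, fun T' hT' => ⟨U, hU, h T' hT'⟩⟩

/-- Primitivity: for some `n ≥ 1`, every `n`-supertile contains tiles of all types. -/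
def IsPrimitive : Prop :=
  ∃ n : ℕ, 0 < n ∧ ∀ i j : ι, ∃ v : Eu d, (j, v) ∈ σ.supertile n i

/-- No tiling in `Ω` has a nonzero translational period. -/
def NonPeriodic : Prop :=
  ∀ T : Set (ι × Eu d), σ.Admissible T → ∀ v : Eu d, translate v T = T → v = 0

/-- In admissible tilings the tiles meet full facet to full facet (full edge to full edge, if
`d = 2`): facets of two different tiles coincide or do not overlap. -/
def MeetsFaceToFace : Prop :=
  ∀ T : Set (ι × Eu d), σ.Admissible T → ∀ p ∈ T, ∀ q ∈ T, p ≠ q →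
    ∀ F ∈ σ.placedFacets p, ∀ G ∈ σ.placedFacets q,
      F = G ∨ Disjoint (intrinsicInterior ℝ F) (intrinsicInterior ℝ G)

/-- Finite local complexity with respect to translations: for every `R`, the patches of radius `R`
in admissible tilings form finitely many classes up to translation. -/
def HasFLC : Prop :=
  ∀ R : ℝ, 0 < R → ∃ Q : Set (Set (ι × Eu d)), Q.Finite ∧
    ∀ T : Set (ι × Eu d), σ.Admissible T → ∀ x : Eu d, ∃ P ∈ Q, ∃ v : Eu d,
      σ.touching T (Metric.closedBall x R) = translate v P

/-- The pattern of ordinary tiles of `σ^k(S)` that touch the `k`-supertile obtained from the tile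
`(i, u)` of `S`, translated so that this supertile is the standard one. -/
def surroundings (k : ℕ) (S : Set (ι × Eu d)) (i : ι) (u : Eu d) : Set (ι × Eu d) :=
  translate (-(σ.factor ^ k • u))
    (σ.touching (σ.apply^[k] S) ((fun x => σ.factor ^ k • x) '' σ.supp (i, u)))

/-- Forcing the border at level `k`: any two `k`-supertiles of the same type, in any admissible
tilings, are surrounded by the same pattern of ordinary tiles. -/
def ForcesBorderAt (k : ℕ) : Prop :=
  ∀ S S' : Set (ι × Eu d), σ.Admissible S → σ.Admissible S' → ∀ (i : ι) (u u' : Eu d),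
    (i, u) ∈ S → (i, u') ∈ S' → σ.surroundings k S i u = σ.surroundings k S' i u'

/-- Forcing the border (at some level). -/
def ForcesBorder : Prop := ∃ k : ℕ, σ.ForcesBorderAt k

/-- The disjoint union of one copy of each (closed) prototile. -/
abbrev PrototilePoint : Type _ := Σ i : ι, (σ.tile i).carrier

/-- The gluing: if somewhere in an admissible tiling a facet `F` of a tile of type `i` coincides
with a facet `G` of a tile of type `j`, then `F` and `G` are identified. -/
def Glued (a b : σ.PrototilePoint) : Prop :=
  ∃ (T : Set (ι × Eu d)) (u v : Eu d), σ.Admissible T ∧ (a.1, u) ∈ T ∧ (b.1, v) ∈ T ∧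
    ∃ F ∈ (σ.tile a.1).facets, ∃ G ∈ (σ.tile b.1).facets,
      (fun x => x + u) '' F = (fun x => x + v) '' G ∧
      a.2.1 ∈ F ∧ b.2.1 ∈ G ∧ a.2.1 + u = b.2.1 + v

/-- The (uncollared) Anderson–Putnam complex `Γ_AP`: the quotient of the disjoint union of the
prototiles by the equivalence relation generated by the gluing of facets. -/
def APComplex : Type _ := Quot σ.Glued

instance : TopologicalSpace σ.APComplex := inferInstanceAs (TopologicalSpace (Quot σ.Glued))

/-- The point of `Γ_AP` represented by a point of a prototile. -/
def toAP (a : σ.PrototilePoint) : σ.APComplex := Quot.mk σ.Glued a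

/-- `f` is the map `Γ_AP → Γ_AP` induced by the substitution: stretch each tile by `λ`, divide it
into tiles by the substitution rule, and send each piece to the corresponding prototile. -/
def IsInducedMap (f : σ.APComplex → σ.APComplex) : Prop :=
  ∀ a b : σ.PrototilePoint, ∀ w : Eu d, (b.1, w) ∈ σ.rule a.1 →
    σ.factor • a.2.1 = b.2.1 + w → f (σ.toAP a) = σ.toAP b

/-- There is at most one induced map. -/
theorem IsInducedMap.unique {σ : Substitution d ι} {f g : σ.APComplex → σ.APComplex}
    (hf : σ.IsInducedMap f) (hg : σ.IsInducedMap g) : f = g := by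
  funext z
  obtain ⟨a, rfl⟩ : ∃ a, σ.toAP a = z := Quot.exists_rep z
  have h : σ.factor • a.2.1 ∈ (fun x => σ.factor • x) '' (σ.tile a.1).carrier :=
    ⟨a.2.1, a.2.2, rfl⟩
  rw [← σ.rule_cover a.1] at h
  simp only [mem_iUnion] at h
  obtain ⟨p, hp, y, hy, hyp⟩ := h
  rw [hf a ⟨p.1, y, hy⟩ p.2 hp hyp.symm, hg a ⟨p.1, y, hy⟩ p.2 hp hyp.symm]

end Substitution

/-- The inverse limit of spaces `Γ n` under maps `ρ n : Γ (n + 1) → Γ n`, with the topology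
induced from the product. -/
def InverseLimit (Γ : ℕ → Type*) (ρ : ∀ n, Γ (n + 1) → Γ n) : Type _ :=
  {x : ∀ n, Γ n // ∀ n, ρ n (x (n + 1)) = x n}

instance (Γ : ℕ → Type*) [∀ n, TopologicalSpace (Γ n)] (ρ : ∀ n, Γ (n + 1) → Γ n) :
    TopologicalSpace (InverseLimit Γ ρ) :=
  inferInstanceAs (TopologicalSpace {x : ∀ n, Γ n // ∀ n, ρ n (x (n + 1)) = x n})

end SubstitutionTiling

end

/-! An admissible tiling `T` has, for each `n`, exactly one admissible `n`-fold preimage `S_n` with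
`σ^n(S_n) = T`. The homeomorphism sends `T` to the sequence of points of the Anderson–Putnam complex
at which the origin lies in `S_0, S_1, …`.

Existence of preimages is a compactness argument (`exists_preimage_limit`). Uniqueness
(`apply_injOn`) uses non-periodicity: by repetitivity, a patch cannot agree with a nonzero shift of
itself that is short compared to its radius (`exists_repulsion_const`). A pigeonhole on the
successive preimages of two tilings with the same image forces them to agree, since otherwise such a
shift would arise.

The position of the origin is well defined when several tiles contain it (`originIn_eq`): the set
where distinct facets meet without overlapping has codimension at least two, so a generic short
segment between two such tiles crosses only common facets, and these are glued.

Forcing the border lets the complex remember enough: the point at the origin determines `σ^m` of the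
tiling on a ball of some radius `ε` (`ForcesBorder.exists_agree`), so coordinate `n + m` determines
`T` on the ball of radius `λ^n ε`. This gives injectivity, convergence of approximants in the proof
of surjectivity, and openness. Continuity comes from local recognizability
(`exists_recognizability_radius`): a large patch of `T` determines a patch of `S_n`. -/

noncomputable section

namespace SubstitutionTiling

/-! ### Translations of patches. -/

section Translate

variable {d : ℕ} {ι : Type*}

theorem mem_translate {v : Eu d} {P : Set (ι × Eu d)} {p : ι × Eu d} :
    p ∈ translate v P ↔ (p.1, p.2 - v) ∈ P := by
  constructor
  · rintro ⟨q, hq, rfl⟩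
    simpa using hq
  · intro h
    exact ⟨_, h, by simp⟩

theorem translate_zero (P : Set (ι × Eu d)) : translate 0 P = P := by
  ext p; simp [mem_translate]

theorem translate_translate (v w : Eu d) (P : Set (ι × Eu d)) :
    translate v (translate w P) = translate (w + v) P := by
  ext p; simp only [mem_translate, sub_sub, add_comm]

theorem translate_mono {v : Eu d} {P Q : Set (ι × Eu d)} (h : P ⊆ Q) :
    translate v P ⊆ translate v Q := image_mono h

end Translate

theorem exists_pos_forall_le {α : Type*} [Finite α] (r : α → ℝ) (hr : ∀ a, 0 < r a) :
    ∃ ρ > 0, ∀ a, ρ ≤ r a := by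
  rcases isEmpty_or_nonempty α with h | h
  · exact ⟨1, one_pos, fun a => h.elim a⟩
  · obtain ⟨a, ha⟩ := Finite.exists_min r
    exact ⟨r a, hr a, ha⟩

namespace Substitution

variable {d : ℕ} {ι : Type*} {σ : Substitution d ι}

/-! ### Geometry of placed tiles. -/

section Supp

theorem factor_pos : 0 < σ.factor := one_pos.trans σ.one_lt_factor

theorem factor_pow_pos (n : ℕ) : 0 < σ.factor ^ n := pow_pos σ.factor_pos n

theorem mem_supp {p : ι × Eu d} {x : Eu d} :
    x ∈ σ.supp p ↔ x - p.2 ∈ (σ.tile p.1).carrier := by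
  constructor
  · rintro ⟨y, hy, rfl⟩
    simpa using hy
  · intro h
    exact ⟨_, h, by simp⟩

theorem mem_supp_add {i : ι} {u v x : Eu d} :
    x ∈ σ.supp (i, u + v) ↔ x - v ∈ σ.supp (i, u) := by
  simp only [mem_supp, sub_sub, add_comm]

theorem supp_eq_image (p : ι × Eu d) :
    σ.supp p = Homeomorph.addRight p.2 '' (σ.tile p.1).carrier := rfl

theorem isCompact_supp (p : ι × Eu d) : IsCompact (σ.supp p) :=
  (σ.tile p.1).isCompact.image (by fun_prop)

theorem isClosed_supp (p : ι × Eu d) : IsClosed (σ.supp p) := (isCompact_supp p).isClosed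

theorem closure_interior_supp (p : ι × Eu d) : closure (interior (σ.supp p)) = σ.supp p := by
  rw [supp_eq_image, ← Homeomorph.image_interior, ← Homeomorph.image_closure,
    (σ.tile p.1).closure_interior]

theorem mem_interior_supp {p : ι × Eu d} {x : Eu d} :
    x ∈ interior (σ.supp p) ↔ x - p.2 ∈ interior (σ.tile p.1).carrier := by
  rw [supp_eq_image, ← Homeomorph.image_interior]
  constructor
  · rintro ⟨y, hy, rfl⟩
    simpa using hy
  · intro h
    exact ⟨_, h, by simp⟩

theorem interior_supp_nonempty (p : ι × Eu d) : (interior (σ.supp p)).Nonempty := by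
  obtain ⟨x, hx⟩ := (σ.tile p.1).isConnected_interior.nonempty
  exact ⟨x + p.2, by simpa [mem_interior_supp] using hx⟩

theorem supp_nonempty (p : ι × Eu d) : (σ.supp p).Nonempty :=
  (interior_supp_nonempty p).mono interior_subset

/-- An open set that meets a tile meets its interior. -/
theorem inter_interior_supp_nonempty {p : ι × Eu d} {U : Set (Eu d)} (hU : IsOpen U)
    (h : (σ.supp p ∩ U).Nonempty) : (interior (σ.supp p) ∩ U).Nonempty := by
  obtain ⟨x, hx, hxU⟩ := h
  rw [← closure_interior_supp] at hx
  obtain ⟨y, hy⟩ := mem_closure_iff.1 hx U hU hxU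
  exact ⟨y, hy.2, hy.1⟩

variable (σ) in
theorem exists_diam_bound [Finite ι] :
    ∃ D > 0, ∀ p : ι × Eu d, ∀ x ∈ σ.supp p, ∀ y ∈ σ.supp p, ‖x - y‖ ≤ D := by
  have hb : Bornology.IsBounded (⋃ i, (σ.tile i).carrier) :=
    (Bornology.isBounded_iUnion).2 fun i => (σ.tile i).isCompact.isBounded
  obtain ⟨C, hC, h⟩ := hb.exists_pos_norm_le
  refine ⟨C + C, by positivity, fun p x hx y hy => ?_⟩
  rw [mem_supp] at hx hy
  calc ‖x - y‖ = ‖(x - p.2) - (y - p.2)‖ := by congr 1; abel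
    _ ≤ _ := (norm_sub_le _ _).trans
      (add_le_add (h _ (mem_iUnion.2 ⟨_, hx⟩)) (h _ (mem_iUnion.2 ⟨_, hy⟩)))

variable (σ) in
theorem exists_inner_radius [Finite ι] :
    ∃ r > 0, ∀ p : ι × Eu d, ∃ c, Metric.ball c r ⊆ interior (σ.supp p) := by
  have h : ∀ i, ∃ r > 0, ∃ c, Metric.ball c r ⊆ interior (σ.tile i).carrier := fun i => by
    obtain ⟨x, hx⟩ := (σ.tile i).isConnected_interior.nonempty
    obtain ⟨r, hr, h⟩ := Metric.isOpen_iff.1 isOpen_interior x hx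
    exact ⟨r, hr, x, h⟩
  choose r hr c hc using h
  obtain ⟨ρ, hρ, hle⟩ := exists_pos_forall_le r hr
  refine ⟨ρ, hρ, fun p => ⟨c p.1 + p.2, fun x hx => ?_⟩⟩
  rw [mem_interior_supp]
  apply hc p.1
  rw [Metric.mem_ball, dist_eq_norm] at hx ⊢
  rw [show x - p.2 - c p.1 = x - (c p.1 + p.2) by abel]
  exact hx.trans_le (hle _)

end Supp

/-! ### Non-overlapping tiles and local finiteness. -/

section NonOverlap

/-- Distinct tiles of `P` have disjoint interiors. -/
def NonOverlapping (σ : Substitution d ι) (P : Set (ι × Eu d)) : Prop :=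
  ∀ p ∈ P, ∀ q ∈ P, p ≠ q → Disjoint (interior (σ.supp p)) (interior (σ.supp q))

theorem NonOverlapping.eq_of_inter_nonempty {P : Set (ι × Eu d)} (hP : σ.NonOverlapping P)
    {p q : ι × Eu d} (hp : p ∈ P) (hq : q ∈ P)
    (h : (interior (σ.supp p) ∩ interior (σ.supp q)).Nonempty) : p = q := by
  by_contra hne
  exact h.ne_empty (hP p hp q hq hne).inter_eq

theorem NonOverlapping.eq_of_mem_interior {P : Set (ι × Eu d)} (hP : σ.NonOverlapping P)
    {p q : ι × Eu d} (hp : p ∈ P) (hq : q ∈ P) {x : Eu d} (hx : x ∈ σ.supp p)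
    (hx' : x ∈ interior (σ.supp q)) : p = q :=
  hP.eq_of_inter_nonempty hp hq (inter_interior_supp_nonempty isOpen_interior ⟨x, hx, hx'⟩)

/-- If some tiles of `T` already cover an open set, no other tile of `T` meets it. -/
theorem NonOverlapping.mem_of_cover {P T : Set (ι × Eu d)} (hT : σ.NonOverlapping T)
    (hPT : P ⊆ T) {U : Set (Eu d)} (hU : IsOpen U) (hcov : ∀ x ∈ U, ∃ p ∈ P, x ∈ σ.supp p)
    {q : ι × Eu d} (hq : q ∈ T) (hqU : (σ.supp q ∩ U).Nonempty) : q ∈ P := by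
  obtain ⟨x, hx, hxU⟩ := inter_interior_supp_nonempty hU hqU
  obtain ⟨p, hp, hxp⟩ := hcov x hxU
  rwa [← hT.eq_of_mem_interior (hPT hp) hq hxp hx]

open MeasureTheory in
-- A packing argument: disjoint sets of volume bounded below cannot be infinitely many inside a set
-- of finite volume.
theorem finite_of_disjoint_of_ball_subset {α : Type*} {A : α → Set (Eu d)} {B : Set (Eu d)}
    {r : ℝ} (hr : 0 < r) (hB : Bornology.IsBounded B) (hA : ∀ a, IsOpen (A a))
    (hd : Pairwise (Function.onFun Disjoint A)) (hAB : ∀ a, A a ⊆ B)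
    (hball : ∀ a, ∃ c, Metric.ball c r ⊆ A a) : Finite α := by
  have hm : volume (⋃ a, A a) ≠ ⊤ :=
    ((measure_mono (iUnion_subset hAB)).trans_lt hB.measure_lt_top).ne
  have hfin := Measure.finite_const_le_meas_of_disjoint_iUnion (volume : Measure (Eu d))
    (Metric.measure_ball_pos volume (0 : Eu d) hr) (fun a => (hA a).measurableSet) hd hm
  have huniv : {a | volume (Metric.ball (0 : Eu d) r) ≤ volume (A a)} = univ := by
    refine eq_univ_of_forall fun a => ?_
    obtain ⟨c, hc⟩ := hball a
    exact (Measure.addHaar_ball_center volume c r).ge.trans (measure_mono hc)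
  rw [huniv] at hfin
  exact Set.finite_univ_iff.1 hfin

theorem NonOverlapping.finite_touching [Finite ι] {T : Set (ι × Eu d)} (hT : σ.NonOverlapping T)
    (x : Eu d) (R : ℝ) : (σ.touching T (Metric.closedBall x R)).Finite := by
  obtain ⟨D, -, hD⟩ := σ.exists_diam_bound
  obtain ⟨r, hr, hr'⟩ := σ.exists_inner_radius
  refine Set.finite_coe_iff.1 (finite_of_disjoint_of_ball_subset
    (A := fun p : σ.touching T (Metric.closedBall x R) => interior (σ.supp p.1))
    (B := Metric.closedBall x (D + R)) hr Metric.isBounded_closedBall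
    (fun p => isOpen_interior)
    (fun p q hpq => hT p.1 p.2.1 q.1 q.2.1 (fun h => hpq (Subtype.ext h))) ?_ fun p => hr' p.1)
  rintro ⟨p, -, y, hy, hyx⟩
  intro z hz
  rw [Metric.mem_closedBall] at hyx ⊢
  refine (dist_triangle z y x).trans (add_le_add ?_ hyx)
  rw [dist_eq_norm]
  exact hD p z (interior_subset hz) y hy

/-- Tiles that come close enough to a compact set touch it. -/
theorem NonOverlapping.exists_thickening [Finite ι] {T : Set (ι × Eu d)}
    (hT : σ.NonOverlapping T) {K : Set (Eu d)} (hK : IsCompact K) :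
    ∃ ε > 0, ∀ p ∈ T, (σ.supp p ∩ Metric.thickening ε K).Nonempty → (σ.supp p ∩ K).Nonempty := by
  obtain ⟨R, hR⟩ := hK.isBounded.subset_closedBall (0 : Eu d)
  set F := σ.touching T (Metric.closedBall 0 (R + 1))
  have hF : F.Finite := hT.finite_touching _ _
  have h : ∀ p : ι × Eu d, ∃ δ > 0, (σ.supp p ∩ Metric.thickening δ K).Nonempty →
      (σ.supp p ∩ K).Nonempty := fun p => by
    by_cases hp : (σ.supp p ∩ K).Nonempty
    · exact ⟨1, one_pos, fun _ => hp⟩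
    · have hd : Disjoint (σ.supp p) K := by
        rwa [disjoint_iff_inter_eq_empty, ← not_nonempty_iff_eq_empty]
      obtain ⟨δ, hδ, hd'⟩ := hd.exists_thickenings (isCompact_supp p) hK.isClosed
      refine ⟨δ, hδ, fun ⟨x, hx, hx'⟩ => ?_⟩
      exact absurd hx' (Set.disjoint_left.1 hd' (Metric.self_subset_thickening hδ _ hx))
  choose δ hδ hδ' using h
  have := hF.to_subtype
  obtain ⟨ε, hε, hle⟩ := exists_pos_forall_le (fun p : F => δ p.1) fun p => hδ p.1
  -- The bound `1` keeps the tile within the radius `R + 1` that defines the finite set `F`.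
  refine ⟨min ε 1, lt_min hε one_pos, fun p hp hpK => ?_⟩
  have hpF : p ∈ F := by
    refine ⟨hp, hpK.mono (inter_subset_inter_right _ fun x hx => ?_)⟩
    obtain ⟨z, hz, hxz⟩ := Metric.mem_thickening_iff.1 hx
    rw [Metric.mem_closedBall]
    have h1 := Metric.mem_closedBall.1 (hR hz)
    have h2 := dist_triangle x z 0
    have h3 := hxz.trans_le (min_le_right _ _)
    linarith
  exact hδ' p (hpK.mono (inter_subset_inter_right _
    (Metric.thickening_mono ((min_le_left _ _).trans (hle ⟨p, hpF⟩)) _)))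

end NonOverlap

/-! ### Iterated substitution of patches. -/

section Apply

theorem apply_mono : Monotone σ.apply := fun _ _ h _ ⟨p, hp, hr⟩ => ⟨p, h hp, hr⟩

theorem iterate_mono (n : ℕ) : Monotone σ.apply^[n] := apply_mono.iterate n

theorem mem_apply_iff {P : Set (ι × Eu d)} {q : ι × Eu d} :
    q ∈ σ.apply P ↔ ∃ p ∈ P, q ∈ σ.apply {p} := by
  simp [apply]

theorem mem_iterate_iff {n : ℕ} {P : Set (ι × Eu d)} {q : ι × Eu d} :
    q ∈ σ.apply^[n] P ↔ ∃ p ∈ P, q ∈ σ.apply^[n] {p} := by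
  induction n generalizing q with
  | zero => simp
  | succ n ih =>
    simp only [Function.iterate_succ_apply']
    rw [mem_apply_iff]
    constructor
    · rintro ⟨p, hp, hq⟩
      obtain ⟨s, hs, hps⟩ := ih.1 hp
      exact ⟨s, hs, mem_apply_iff.2 ⟨p, hps, hq⟩⟩
    · rintro ⟨s, hs, hq⟩
      obtain ⟨p, hp, hpq⟩ := mem_apply_iff.1 hq
      exact ⟨p, ih.2 ⟨s, hs, hp⟩, hpq⟩

theorem apply_translate (v : Eu d) (P : Set (ι × Eu d)) :
    σ.apply (translate v P) = translate (σ.factor • v) (σ.apply P) := by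
  ext ⟨j, w⟩
  rw [mem_translate]
  constructor
  · rintro ⟨p, hp, r, hr, he⟩
    refine ⟨_, mem_translate.1 hp, r, hr, ?_⟩
    simp only [Prod.mk.injEq] at he ⊢
    exact ⟨he.1, by rw [he.2, smul_sub]; abel⟩
  · rintro ⟨p, hp, r, hr, he⟩
    refine ⟨(p.1, p.2 + v), mem_translate.2 (by simpa using hp), r, hr, ?_⟩
    simp only [Prod.mk.injEq, sub_eq_iff_eq_add] at he ⊢
    exact ⟨he.1, by rw [he.2, smul_add]; abel⟩

theorem iterate_translate (n : ℕ) (v : Eu d) (P : Set (ι × Eu d)) :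
    σ.apply^[n] (translate v P) = translate (σ.factor ^ n • v) (σ.apply^[n] P) := by
  induction n with
  | zero => simp
  | succ n ih => rw [Function.iterate_succ_apply', Function.iterate_succ_apply', ih,
      apply_translate, smul_smul, pow_succ']

theorem exists_smul_of_mem_apply {p q : ι × Eu d} (hq : q ∈ σ.apply {p}) {y : Eu d}
    (hy : y ∈ σ.supp q) : ∃ x ∈ σ.supp p, y = σ.factor • x := by
  obtain ⟨p, rfl, r, hr, rfl⟩ := hq
  rw [mem_supp] at hy
  have h : y - σ.factor • p.2 ∈ (fun x => σ.factor • x) '' (σ.tile p.1).carrier := by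
    rw [← σ.rule_cover p.1]
    exact mem_iUnion₂.2 ⟨r, hr, mem_supp.2 (by rwa [sub_sub])⟩
  obtain ⟨x, hx, hxy⟩ := h
  refine ⟨x + p.2, mem_supp.2 (by simpa using hx), ?_⟩
  dsimp only at hxy
  rw [smul_add, hxy]
  abel

theorem exists_mem_apply {p : ι × Eu d} {x : Eu d} (hx : x ∈ σ.supp p) :
    ∃ q ∈ σ.apply {p}, σ.factor • x ∈ σ.supp q := by
  rw [mem_supp] at hx
  have h : σ.factor • (x - p.2) ∈ (fun x => σ.factor • x) '' (σ.tile p.1).carrier := ⟨_, hx, rfl⟩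
  rw [← σ.rule_cover p.1] at h
  obtain ⟨r, hr, h⟩ := mem_iUnion₂.1 h
  refine ⟨_, ⟨p, rfl, r, hr, rfl⟩, ?_⟩
  have h' : σ.factor • (x - p.2) ∈ σ.supp r := h
  rw [mem_supp] at h' ⊢
  rwa [← sub_sub, ← smul_sub]

theorem exists_smul_of_mem_iterate {n : ℕ} {p q : ι × Eu d} (hq : q ∈ σ.apply^[n] {p})
    {y : Eu d} (hy : y ∈ σ.supp q) : ∃ x ∈ σ.supp p, y = σ.factor ^ n • x := by
  induction n generalizing q y with
  | zero =>
    obtain rfl : q = p := hq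
    exact ⟨y, hy, by simp⟩
  | succ n ih =>
    rw [Function.iterate_succ_apply'] at hq
    obtain ⟨s, hs, hq⟩ := mem_apply_iff.1 hq
    obtain ⟨z, hz, rfl⟩ := exists_smul_of_mem_apply hq hy
    obtain ⟨x, hx, rfl⟩ := ih hs hz
    exact ⟨x, hx, by rw [smul_smul, pow_succ']⟩

theorem exists_mem_iterate (n : ℕ) {p : ι × Eu d} {x : Eu d} (hx : x ∈ σ.supp p) :
    ∃ q ∈ σ.apply^[n] {p}, σ.factor ^ n • x ∈ σ.supp q := by
  induction n with
  | zero => exact ⟨p, rfl, by simpa using hx⟩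
  | succ n ih =>
    obtain ⟨s, hs, hx⟩ := ih
    obtain ⟨q, hq, hxq⟩ := exists_mem_apply hx
    refine ⟨q, ?_, by rwa [smul_smul, ← pow_succ'] at hxq⟩
    rw [Function.iterate_succ_apply']
    exact mem_apply_iff.2 ⟨s, hs, hq⟩

theorem apply_singleton_nonempty (p : ι × Eu d) : (σ.apply {p}).Nonempty := by
  obtain ⟨x, hx⟩ := supp_nonempty (σ := σ) p
  obtain ⟨q, hq, -⟩ := exists_mem_apply hx
  exact ⟨q, hq⟩

theorem singleton_eq_translate (p : ι × Eu d) :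
    ({p} : Set (ι × Eu d)) = translate p.2 {(p.1, 0)} := by
  ext q
  rw [mem_translate]
  simp [Prod.ext_iff, sub_eq_zero]

theorem iterate_singleton (n : ℕ) (p : ι × Eu d) :
    σ.apply^[n] {p} = translate (σ.factor ^ n • p.2) (σ.supertile n p.1) := by
  rw [singleton_eq_translate, iterate_translate]; rfl

theorem smul_mem_interior_of_mem_apply {p q : ι × Eu d} (hq : q ∈ σ.apply {p}) {y : Eu d}
    (hy : y ∈ interior (σ.supp q)) : σ.factor⁻¹ • y ∈ interior (σ.supp p) := by
  have h0 := σ.factor_pos.ne'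
  have hsub : σ.supp q ⊆ (fun x => σ.factor⁻¹ • x) ⁻¹' σ.supp p := by
    intro z hz
    obtain ⟨x, hx, rfl⟩ := exists_smul_of_mem_apply hq hz
    simpa [smul_smul, h0] using hx
  have hcont : Continuous fun x : Eu d => σ.factor⁻¹ • x := by fun_prop
  refine interior_maximal (s := σ.supp p) (t := (fun x => σ.factor⁻¹ • x) '' interior (σ.supp q))
    ?_ ?_ ⟨y, hy, rfl⟩
  · rintro _ ⟨z, hz, rfl⟩
    exact hsub (interior_subset hz)
  · exact isOpenMap_smul₀ (inv_ne_zero h0) _ isOpen_interior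

theorem NonOverlapping.apply {P : Set (ι × Eu d)} (hP : σ.NonOverlapping P) :
    σ.NonOverlapping (σ.apply P) := by
  intro q hq q' hq' hne
  obtain ⟨p, hp, hqp⟩ := mem_apply_iff.1 hq
  obtain ⟨p', hp', hqp'⟩ := mem_apply_iff.1 hq'
  rw [Set.disjoint_left]
  intro y hy hy'
  have hpp : p = p' := hP.eq_of_inter_nonempty hp hp'
    ⟨_, smul_mem_interior_of_mem_apply hqp hy, smul_mem_interior_of_mem_apply hqp' hy'⟩
  subst hpp
  obtain ⟨s, hs, r, hr, rfl⟩ := hqp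
  obtain ⟨s', hs', r', hr', rfl⟩ := hqp'
  obtain rfl : s = p := hs
  obtain rfl : s' = s := hs'
  have hd := Set.disjoint_left.1 (σ.rule_nonoverlapping _ r hr r' hr'
    (by rintro rfl; exact hne rfl))
  refine @hd (y - σ.factor • s'.2) (mem_interior_supp.2 ?_) (mem_interior_supp.2 ?_)
  · simpa [mem_interior_supp, sub_sub] using hy
  · simpa [mem_interior_supp, sub_sub] using hy'

theorem NonOverlapping.iterate {P : Set (ι × Eu d)} (hP : σ.NonOverlapping P) (n : ℕ) :
    σ.NonOverlapping (σ.apply^[n] P) := by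
  induction n with
  | zero => exact hP
  | succ n ih => rw [Function.iterate_succ_apply']; exact ih.apply

theorem nonOverlapping_singleton (p : ι × Eu d) : σ.NonOverlapping {p} := by
  rintro _ rfl _ rfl h
  exact absurd rfl h

theorem NonOverlapping.translate {P : Set (ι × Eu d)} (hP : σ.NonOverlapping P) (v : Eu d) :
    σ.NonOverlapping (translate v P) := by
  intro p hp q hq hne
  rw [mem_translate] at hp hq
  rw [Set.disjoint_left]
  intro y hy hy'
  have hd := Set.disjoint_left.1 (hP _ hp _ hq fun h => hne ?_)
  · refine @hd (y - v) ?_ ?_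
    · simpa [mem_interior_supp] using hy
    · simpa [mem_interior_supp] using hy'
  · simp only [Prod.mk.injEq, sub_left_inj] at h
    exact Prod.ext h.1 h.2

end Apply

/-! ### Substitution of admissible tilings. -/

section Tiling

theorem isTiling_iff {T : Set (ι × Eu d)} :
    σ.IsTiling T ↔ (∀ x, ∃ p ∈ T, x ∈ σ.supp p) ∧ σ.NonOverlapping T := by
  simp [IsTiling, NonOverlapping, eq_univ_iff_forall]

theorem IsTiling.exists_mem {T : Set (ι × Eu d)} (hT : σ.IsTiling T) (x : Eu d) :
    ∃ p ∈ T, x ∈ σ.supp p := (isTiling_iff.1 hT).1 x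

theorem IsTiling.translate {T : Set (ι × Eu d)} (hT : σ.IsTiling T) (v : Eu d) :
    σ.IsTiling (translate v T) := by
  refine isTiling_iff.2 ⟨fun x => ?_, NonOverlapping.translate hT.2 v⟩
  obtain ⟨p, hp, hx⟩ := hT.exists_mem (x - v)
  exact ⟨(p.1, p.2 + v), mem_translate.2 (by simpa using hp), mem_supp_add.2 hx⟩

theorem IsTiling.apply {T : Set (ι × Eu d)} (hT : σ.IsTiling T) : σ.IsTiling (σ.apply T) := by
  refine isTiling_iff.2 ⟨fun x => ?_, NonOverlapping.apply hT.2⟩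
  obtain ⟨p, hp, hx⟩ := hT.exists_mem (σ.factor⁻¹ • x)
  obtain ⟨q, hq, hxq⟩ := exists_mem_apply hx
  exact ⟨q, mem_apply_iff.2 ⟨p, hp, hq⟩, by rwa [smul_inv_smul₀ σ.factor_pos.ne'] at hxq⟩

theorem Admissible.translate {T : Set (ι × Eu d)} (hT : σ.Admissible T) (v : Eu d) :
    σ.Admissible (translate v T) := by
  refine ⟨hT.1.translate v, fun P hP hfin => ?_⟩
  obtain ⟨n, i, w, hw⟩ := hT.2 (SubstitutionTiling.translate (-v) P) (fun p hp => by
    simpa [mem_translate] using hP (mem_translate.1 hp)) (hfin.image _)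
  exact ⟨n, i, -v + w, by rwa [translate_translate] at hw⟩

theorem Admissible.apply {T : Set (ι × Eu d)} (hT : σ.Admissible T) :
    σ.Admissible (σ.apply T) := by
  refine ⟨hT.1.apply, fun P hP hfin => ?_⟩
  choose! f hf hf' using fun q (hq : q ∈ P) => mem_apply_iff.1 (hP hq)
  obtain ⟨n, i, w, hw⟩ := hT.2 (f '' P) (image_subset_iff.2 hf) (hfin.image f)
  refine ⟨n + 1, i, σ.factor • w, ?_⟩
  rw [supertile, Function.iterate_succ_apply']
  refine subset_trans ?_ (apply_mono hw)
  rw [apply_translate]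
  exact translate_mono fun q hq => mem_apply_iff.2 ⟨f q, mem_image_of_mem f hq, hf' q hq⟩

theorem Admissible.iterate {T : Set (ι × Eu d)} (hT : σ.Admissible T) (n : ℕ) :
    σ.Admissible (σ.apply^[n] T) := by
  induction n with
  | zero => exact hT
  | succ n ih => rw [Function.iterate_succ_apply']; exact ih.apply

end Tiling

/-! ### Local agreement of tilings. -/

section Agree

/-- The tiles of `S` that meet `U` are tiles of `T`. -/
def Agree (σ : Substitution d ι) (S T : Set (ι × Eu d)) (U : Set (Eu d)) : Prop :=
  ∀ p ∈ S, (σ.supp p ∩ U).Nonempty → p ∈ T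

theorem Agree.mono {S T : Set (ι × Eu d)} {U V : Set (Eu d)} (h : σ.Agree S T V) (hUV : U ⊆ V) :
    σ.Agree S T U := fun p hp hpU => h p hp (hpU.mono (inter_subset_inter_right _ hUV))

theorem Agree.trans {S T W : Set (ι × Eu d)} {U : Set (Eu d)} (h : σ.Agree S T U)
    (h' : σ.Agree T W U) : σ.Agree S W U := fun p hp hpU => h' p (h p hp hpU) hpU

/-- The tiles of `S` that meet the open set `U` already cover it and belong to `T`, which leaves no
room in `U` for other tiles of `T`. -/
theorem Agree.symm {S T : Set (ι × Eu d)} {U : Set (Eu d)} (h : σ.Agree S T U)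
    (hU : IsOpen U) (hS : σ.IsTiling S) (hT : σ.IsTiling T) : σ.Agree T S U := by
  intro q hq hqU
  refine (NonOverlapping.mem_of_cover (P := {p ∈ S | (σ.supp p ∩ U).Nonempty}) (T := T)
    hT.2 (fun p hp => h p hp.1 hp.2) hU (fun x hx => ?_) hq hqU).1
  obtain ⟨p, hp, hxp⟩ := hS.exists_mem x
  exact ⟨p, ⟨hp, x, hxp, hx⟩, hxp⟩

theorem eq_of_subset {S T : Set (ι × Eu d)} (h : S ⊆ T) (hS : σ.IsTiling S)
    (hT : σ.IsTiling T) : S = T := by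
  have h' : σ.Agree S T univ := fun p hp _ => h hp
  exact h.antisymm fun p hp => h'.symm isOpen_univ hS hT p hp
    (by simpa using supp_nonempty p)

theorem Agree.translate {S T : Set (ι × Eu d)} {x : Eu d} {R : ℝ}
    (h : σ.Agree S T (Metric.ball x R)) (v : Eu d) :
    σ.Agree (translate v S) (translate v T) (Metric.ball (x + v) R) := by
  rintro p hp ⟨y, hy, hyx⟩
  rw [mem_translate] at hp ⊢
  refine h _ hp ⟨y - v, ?_, ?_⟩
  · rw [mem_supp] at hy ⊢
    simpa using hy
  · rw [Metric.mem_ball, dist_eq_norm] at hyx ⊢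
    rwa [show y - v - x = y - (x + v) by abel]

theorem Agree.iterate {S T : Set (ι × Eu d)} {x : Eu d} {R : ℝ}
    (h : σ.Agree S T (Metric.ball x R)) (n : ℕ) :
    σ.Agree (σ.apply^[n] S) (σ.apply^[n] T)
      (Metric.ball (σ.factor ^ n • x) (σ.factor ^ n * R)) := by
  rintro q hq ⟨y, hy, hyx⟩
  obtain ⟨p, hp, hqp⟩ := mem_iterate_iff.1 hq
  obtain ⟨z, hz, rfl⟩ := exists_smul_of_mem_iterate hqp hy
  refine mem_iterate_iff.2 ⟨p, h p hp ⟨z, hz, ?_⟩, hqp⟩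
  rw [Metric.mem_ball, dist_eq_norm, ← smul_sub, norm_smul, Real.norm_of_nonneg
    (factor_pow_pos n).le] at hyx
  rw [Metric.mem_ball, dist_eq_norm]
  exact lt_of_mul_lt_mul_left hyx (factor_pow_pos n).le

theorem Agree.iterate_zero_ball {S T : Set (ι × Eu d)} {R : ℝ}
    (h : σ.Agree S T (Metric.ball 0 R)) (n : ℕ) :
    σ.Agree (σ.apply^[n] S) (σ.apply^[n] T) (Metric.ball 0 (σ.factor ^ n * R)) := by
  simpa using h.iterate n

theorem eq_of_agree_balls {S T : Set (ι × Eu d)} (hS : σ.IsTiling S) (hT : σ.IsTiling T)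
    (h : ∀ R : ℝ, ∃ R' ≥ R, σ.Agree S T (Metric.ball 0 R')) : S = T := by
  refine eq_of_subset (fun p hp => ?_) hS hT
  obtain ⟨x, hx⟩ := supp_nonempty (σ := σ) p
  obtain ⟨R, hR, h⟩ := h (‖x‖ + 1)
  exact h p hp ⟨x, hx, by rw [mem_ball_zero_iff]; linarith⟩

end Agree

/-! ### Admissible tilings through a prescribed tile. -/

section Existence

open Filter Topology

/-- Once `λ^m r > D`, the tile over the stretched centre of an inscribed ball of radius `r` lies
inside the stretched ball. By primitivity, `n` further substitutions of that tile produce a tile of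
type `i`. -/
theorem exists_inner_supertile [Finite ι] (h : σ.IsPrimitive) (i : ι) :
    ∃ k > 0, ∃ v : Eu d, (i, v) ∈ σ.supertile k i ∧
      ∀ y ∈ σ.supp (i, v), (σ.factor ^ k)⁻¹ • y ∈ interior (σ.supp (i, 0)) := by
  obtain ⟨n, hn, hprim⟩ := h
  obtain ⟨D, -, hD⟩ := σ.exists_diam_bound
  obtain ⟨r, hr, hball⟩ := σ.exists_inner_radius
  obtain ⟨c, hc⟩ := hball (i, 0)
  obtain ⟨m, hm⟩ := pow_unbounded_of_one_lt (D / r) σ.one_lt_factor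
  rw [div_lt_iff₀ hr] at hm
  obtain ⟨q, hq, hcq⟩ := exists_mem_iterate (σ := σ) m
    (interior_subset (hc (Metric.mem_ball_self hr)))
  obtain ⟨v, hv⟩ := hprim q.1 i
  have hmem : (i, v + σ.factor ^ n • q.2) ∈ σ.apply^[n] {q} := by
    rw [iterate_singleton, mem_translate]
    simpa using hv
  refine ⟨n + m, by omega, v + σ.factor ^ n • q.2, ?_, fun y hy => hc ?_⟩
  · rw [supertile, Function.iterate_add_apply]
    exact mem_iterate_iff.2 ⟨q, hq, hmem⟩
  · obtain ⟨z, hz, rfl⟩ := exists_smul_of_mem_iterate hmem hy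
    have h1 := hD q z hz _ hcq
    have hn0 := (factor_pow_pos (σ := σ) n).ne'
    have hm0 := factor_pow_pos (σ := σ) m
    have h2 : (σ.factor ^ (n + m))⁻¹ • σ.factor ^ n • z - c =
        (σ.factor ^ m)⁻¹ • (z - σ.factor ^ m • c) := by
      rw [smul_sub, inv_smul_smul₀ hm0.ne', smul_smul, pow_add]
      congr 2
      field_simp
    rw [Metric.mem_ball, dist_eq_norm, h2, norm_smul, norm_inv, Real.norm_of_nonneg hm0.le,
      inv_mul_lt_iff₀ hm0]
    exact h1.trans_lt hm

/-- A tile of type `i` strictly inside its own `k`-supertile can be placed so that `σ^k` reproduces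
it in place. The origin is then interior to it, so its images under the powers of `σ^k` increase to
a tiling. -/
theorem exists_admissible_mem [Finite ι] (h : σ.IsPrimitive) (i : ι) (u : Eu d) :
    ∃ T, σ.Admissible T ∧ (i, u) ∈ T := by
  obtain ⟨k, hk, v, hv, hint⟩ := exists_inner_supertile h i
  have hL : 1 < σ.factor ^ k := one_lt_pow₀ σ.one_lt_factor hk.ne'
  have hL0 := factor_pow_pos (σ := σ) k
  set L := σ.factor ^ k
  -- The position that `σ^k` fixes: it solves `w = v + L • w`.
  set w : Eu d := (1 - L)⁻¹ • v
  have hw : v + L • w = w := by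
    have : v = (1 - L) • w := by rw [smul_inv_smul₀ (by linarith)]
    nth_rewrite 1 [this]
    rw [sub_smul, one_smul]
    abel
  have hint' : ∀ y ∈ σ.supp (i, w), L⁻¹ • y ∈ interior (σ.supp (i, w)) := by
    intro y hy
    rw [← hw, mem_supp_add] at hy
    have := hint _ hy
    rw [smul_sub, inv_smul_smul₀ hL0.ne', mem_interior_supp] at this
    rw [mem_interior_supp]
    simpa using this
  have hstep : {(i, w)} ⊆ σ.apply^[k] {(i, w)} := by
    rw [singleton_subset_iff, iterate_singleton, mem_translate]
    have : w - σ.factor ^ k • w = v := by rw [sub_eq_iff_eq_add]; exact hw.symm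
    simpa [this] using hv
  have hmono : Monotone fun n => σ.apply^[k * n] {(i, w)} := by
    refine monotone_nat_of_le_succ fun n => ?_
    rw [mul_add, mul_one, Function.iterate_add_apply]
    exact iterate_mono _ hstep
  have hiter : ∀ n : ℕ, ∀ y ∈ σ.supp (i, w), (L⁻¹) ^ n • y ∈ σ.supp (i, w) := by
    intro n y hy
    induction n with
    | zero => simpa using hy
    | succ n ih => rw [pow_succ', ← smul_smul]; exact interior_subset (hint' _ ih)
  have hlim : ∀ y : Eu d, Tendsto (fun n : ℕ => (L⁻¹) ^ n • y) atTop (𝓝 0) := fun y => by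
    have := (tendsto_pow_atTop_nhds_zero_of_lt_one (inv_nonneg.2 hL0.le)
      (inv_lt_one_of_one_lt₀ hL)).smul_const y
    rwa [zero_smul] at this
  -- The contraction by `L⁻¹` maps the closed tile into its interior, so its fixed point `0` is an
  -- interior point.
  have h0 : (0 : Eu d) ∈ interior (σ.supp (i, w)) := by
    obtain ⟨y, hy⟩ := supp_nonempty (σ := σ) (i, w)
    have := hint' 0 ((isClosed_supp _).mem_of_tendsto (hlim y)
      (Eventually.of_forall fun n => hiter n y hy))
    rwa [smul_zero] at this
  refine ⟨translate (u - w) (⋃ n, σ.apply^[k * n] {(i, w)}), Admissible.translate ⟨?_, ?_⟩ _, ?_⟩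
  · refine isTiling_iff.2 ⟨fun x => ?_, fun p hp q hq => ?_⟩
    · obtain ⟨n, hn⟩ := ((hlim x).eventually (mem_interior_iff_mem_nhds.1 h0)).exists
      obtain ⟨q, hq, hxq⟩ := exists_mem_iterate (σ := σ) (k * n) hn
      refine ⟨q, mem_iUnion.2 ⟨n, hq⟩, ?_⟩
      rwa [pow_mul, inv_pow, smul_inv_smul₀ (pow_pos hL0 n).ne'] at hxq
    · obtain ⟨n, hn⟩ := mem_iUnion.1 hp
      obtain ⟨m, hm⟩ := mem_iUnion.1 hq
      exact (nonOverlapping_singleton (σ := σ) (i, w)).iterate (k * max n m) p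
        (hmono (le_max_left n m) hn) q (hmono (le_max_right n m) hm)
  · intro P hP hfin
    choose! f hf using fun q (hq : q ∈ P) => mem_iUnion.1 (hP hq)
    obtain ⟨N, hN⟩ := (hfin.image f).bddAbove
    refine ⟨k * N, i, -(σ.factor ^ (k * N) • w), fun p hp => ?_⟩
    rw [mem_translate] at hp
    have := hmono (hN (mem_image_of_mem f hp)) (hf _ hp)
    dsimp only at this
    rw [iterate_singleton, mem_translate] at this
    simpa using this
  · rw [mem_translate]
    exact mem_iUnion.2 ⟨0, by simp⟩

end Existence

/-! ### Limits of tilings and existence of preimages. -/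

section Limits

open Filter

/-- Covering, non-overlap and admissibility each involve finitely many tiles at a time, so they pass
to a limit that is attained on every ball. The general filter serves both ultrafilter limits and
ordinary ones. -/
theorem admissible_of_eventually {F : Filter ℕ} [NeBot F] {S : ℕ → Set (ι × Eu d)}
    {W : Set (ι × Eu d)} (hS : ∀ j, σ.Admissible (S j))
    (h : ∀ ρ : ℝ, ∀ᶠ j in F, ∀ p, (σ.supp p ∩ Metric.ball 0 ρ).Nonempty → (p ∈ W ↔ p ∈ S j)) :
    σ.Admissible W := by
  have hp : ∀ p, ∀ᶠ j in F, p ∈ W ↔ p ∈ S j := fun p => by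
    obtain ⟨x, hx⟩ := supp_nonempty (σ := σ) p
    filter_upwards [h (‖x‖ + 1)] with j hj
    exact hj p ⟨x, hx, by simp⟩
  refine ⟨isTiling_iff.2 ⟨fun x => ?_, fun p hpW q hqW => ?_⟩, fun P hP hfin => ?_⟩
  · obtain ⟨j, hj⟩ := (h (‖x‖ + 1)).exists
    obtain ⟨p, hpS, hx⟩ := (hS j).1.exists_mem x
    exact ⟨p, (hj p ⟨x, hx, by simp⟩).2 hpS, hx⟩
  · obtain ⟨j, hj, hj'⟩ := ((hp p).and (hp q)).exists
    exact (hS j).1.2 p (hj.1 hpW) q (hj'.1 hqW)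
  · obtain ⟨j, hj⟩ := ((eventually_all_finite hfin).2 fun p _ => hp p).exists
    exact (hS j).2 P (fun p hpP => (hj p hpP).1 (hP hpP)) hfin

/-- Compactness: if `σ (S j)` agrees with `T` on larger and larger balls, then some limit point
of the sequence `S` is a preimage of `T`. -/
theorem exists_preimage_limit [Finite ι] {T : Set (ι × Eu d)} (hT : σ.Admissible T)
    {S : ℕ → Set (ι × Eu d)} (hS : ∀ j, σ.Admissible (S j))
    (h : ∀ j : ℕ, σ.Agree (σ.apply (S j)) T (Metric.ball 0 j)) :
    ∃ W, σ.Admissible W ∧ σ.apply W = T ∧ ∀ ρ : ℝ, ∃ j, σ.Agree W (S j) (Metric.ball 0 ρ) := by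
  obtain ⟨D, hD0, hD⟩ := σ.exists_diam_bound
  -- A limit along a free ultrafilter takes the place of a diagonal subsequence.
  set 𝒰 := hyperfilter ℕ
  have hle : (𝒰 : Filter ℕ) ≤ atTop := by
    rw [← Nat.cofinite_eq_atTop]; exact hyperfilter_le_cofinite
  set W : Set (ι × Eu d) := {p | ∀ᶠ j in (𝒰 : Filter ℕ), p ∈ S j}
  have hnorm : ∀ {p q : ι × Eu d} {ρ : ℝ}, (σ.supp p ∩ Metric.ball 0 ρ).Nonempty →
      q ∈ σ.apply {p} → ∀ y ∈ σ.supp q, ‖y‖ < σ.factor * (ρ + D) := by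
    rintro p q ρ ⟨x, hx, hxρ⟩ hq y hy
    obtain ⟨z, hz, rfl⟩ := exists_smul_of_mem_apply hq hy
    rw [norm_smul, Real.norm_of_nonneg σ.factor_pos.le]
    refine mul_lt_mul_of_pos_left ?_ σ.factor_pos
    have h1 := hD p z hz x hx
    rw [mem_ball_zero_iff] at hxρ
    have h2 := norm_le_insert' z x
    linarith
  -- For large `j`, a tile of `S j` meeting the ball has its substitution inside `T`. Only finitely
  -- many tiles qualify, so tilewise convergence is uniform on the ball.
  have hev : ∀ ρ : ℝ, ∀ᶠ j in (𝒰 : Filter ℕ), ∀ p, (σ.supp p ∩ Metric.ball 0 ρ).Nonempty →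
      (p ∈ W ↔ p ∈ S j) := by
    intro ρ
    set F : Set (ι × Eu d) := {p | (σ.supp p ∩ Metric.ball 0 ρ).Nonempty ∧ σ.apply {p} ⊆ T}
    have hlarge : ∀ᶠ j in (𝒰 : Filter ℕ), ∀ p ∈ S j, (σ.supp p ∩ Metric.ball 0 ρ).Nonempty →
        p ∈ F := by
      filter_upwards [hle (eventually_ge_atTop ⌈σ.factor * (ρ + D)⌉₊)] with j hj p hp hpρ
      refine ⟨hpρ, fun q hq => h j q (mem_apply_iff.2 ⟨p, hp, hq⟩) ?_⟩
      obtain ⟨y, hy⟩ := supp_nonempty (σ := σ) q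
      refine ⟨y, hy, mem_ball_zero_iff.2 ((hnorm hpρ hq y hy).trans_le ?_)⟩
      exact (Nat.le_ceil _).trans (Nat.cast_le.2 hj)
    have hF : F.Finite := by
      -- With one tile marked in the substitution of each type, a tile is recovered from its type
      -- and its marked descendant, which is one of finitely many tiles of `T`.
      choose r hr using fun i : ι => (apply_singleton_nonempty (σ := σ) (i, 0))
      have hr' : ∀ p : ι × Eu d, ((r p.1).1, (r p.1).2 + σ.factor • p.2) ∈ σ.apply {p} := by
        intro p
        rw [singleton_eq_translate, apply_translate, mem_translate]
        simpa using hr p.1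
      have hfin := (Set.finite_univ (α := ι)).prod
        (NonOverlapping.finite_touching hT.1.2 0 (σ.factor * (ρ + D)))
      refine (Set.Finite.preimage (f := fun p : ι × Eu d =>
        (p.1, ((r p.1).1, (r p.1).2 + σ.factor • p.2))) ?_ hfin).subset ?_
      · rintro ⟨i, u⟩ - ⟨j, v⟩ - he
        simp only [Prod.mk.injEq] at he
        obtain ⟨rfl, -, he⟩ := he
        rw [add_right_inj, smul_right_inj σ.factor_pos.ne'] at he
        rw [he]
      · intro p hp
        refine ⟨mem_univ _, hp.2 (hr' p), ?_⟩
        obtain ⟨y, hy⟩ := supp_nonempty (σ := σ) ((r p.1).1, (r p.1).2 + σ.factor • p.2)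
        exact ⟨y, hy, mem_closedBall_zero_iff.2 (hnorm hp.1 (hr' p) y hy).le⟩
    have hdec : ∀ p, ∀ᶠ j in (𝒰 : Filter ℕ), p ∈ W ↔ p ∈ S j := fun p => by
      by_cases hp : p ∈ W
      · filter_upwards [hp] with j hj
        simp [hp, hj]
      · filter_upwards [Ultrafilter.eventually_not.2 hp] with j hj
        simp [hp, hj]
    filter_upwards [hlarge, (eventually_all_finite hF).2 fun p _ => hdec p] with j hj hj' p hpρ
    refine ⟨fun hp => ?_, fun hp => (hj' p (hj p hp hpρ)).2 hp⟩
    obtain ⟨m, hm, hm'⟩ := (hlarge.and hp).exists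
    exact (hj' p (hm p hm' hpρ)).1 hp
  have hW := admissible_of_eventually hS hev
  refine ⟨W, hW, eq_of_subset (fun q hq => ?_) hW.apply.1 hT.1, fun ρ => ?_⟩
  · obtain ⟨p, hp, hqp⟩ := mem_apply_iff.1 hq
    obtain ⟨y, hy⟩ := supp_nonempty (σ := σ) q
    obtain ⟨j, hj, hj'⟩ :=
      (Eventually.and hp (hle (eventually_ge_atTop (⌈‖y‖⌉₊ + 1)))).exists
    refine h j q (mem_apply_iff.2 ⟨p, hj, hqp⟩) ⟨y, hy, mem_ball_zero_iff.2 ?_⟩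
    have h1 := Nat.le_ceil ‖y‖
    have h2 : ((⌈‖y‖⌉₊ + 1 : ℕ) : ℝ) ≤ j := Nat.cast_le.2 hj'
    push_cast at h2
    linarith
  · obtain ⟨j, hj⟩ := (hev ρ).exists
    exact ⟨j, fun p hp hpρ => (hj p hpρ).1 hp⟩

/-- Every admissible tiling is the substitution of an admissible tiling. -/
theorem exists_preimage [Finite ι] (h : σ.IsPrimitive) {T : Set (ι × Eu d)}
    (hT : σ.Admissible T) : ∃ S, σ.Admissible S ∧ σ.apply S = T := by
  -- Primitivity puts a tile of type `i` into `σ^(m+1)(S)`; a shift moves it to the origin.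
  have hroot : ∀ i, ∃ S, σ.Admissible S ∧ (i, 0) ∈ σ.apply S := by
    intro i
    obtain ⟨S, hS, hiS⟩ := exists_admissible_mem h i 0
    obtain ⟨n, hn, hprim⟩ := h
    obtain ⟨v, hv⟩ := hprim i i
    obtain ⟨m, rfl⟩ : ∃ m, n = m + 1 := ⟨n - 1, by omega⟩
    refine ⟨translate (-(σ.factor⁻¹ • v)) (σ.apply^[m] S), (hS.iterate m).translate _, ?_⟩
    rw [apply_translate, smul_neg, smul_inv_smul₀ σ.factor_pos.ne', mem_translate,
      ← Function.iterate_succ_apply' σ.apply]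
    simpa using iterate_mono (m + 1) (singleton_subset_iff.2 hiS) hv
  -- The patch of `T` in the ball occurs in some `n`-supertile. This supertile occurs in `σ^(n+1)`
  -- of an admissible tiling, hence in a tiling of the form `σ(S)`.
  have key : ∀ j : ℕ, ∃ S, σ.Admissible S ∧ σ.Agree (σ.apply S) T (Metric.ball 0 j) := by
    intro j
    obtain ⟨n, i, v, hv⟩ := hT.2 (σ.touching T (Metric.closedBall 0 j)) (fun p hp => hp.1)
      (NonOverlapping.finite_touching hT.1.2 0 j)
    obtain ⟨S, hS, hiS⟩ := hroot i
    refine ⟨translate (-(σ.factor⁻¹ • v)) (σ.apply^[n] S), (hS.iterate n).translate _, ?_⟩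
    refine Agree.symm (fun p hp hpj => ?_) Metric.isOpen_ball hT.1
      ((hS.iterate n).translate _).apply.1
    rw [apply_translate, smul_neg, smul_inv_smul₀ σ.factor_pos.ne', mem_translate,
      ← Function.iterate_succ_apply' σ.apply, Function.iterate_succ_apply]
    have hmem : p ∈ σ.touching T (Metric.closedBall 0 j) :=
      ⟨hp, hpj.mono (inter_subset_inter_right _ Metric.ball_subset_closedBall)⟩
    refine iterate_mono n (singleton_subset_iff.2 hiS) (hv (mem_translate.2 ?_))
    simpa only [sub_neg_eq_add, add_sub_cancel_right] using hmem
  choose S hS hS' using key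
  obtain ⟨W, hW, hWT, -⟩ := exists_preimage_limit hT hS hS'
  exact ⟨W, hW, hWT⟩

theorem exists_iterate_preimage [Finite ι] (h : σ.IsPrimitive) (n : ℕ) {T : Set (ι × Eu d)}
    (hT : σ.Admissible T) : ∃ S, σ.Admissible S ∧ σ.apply^[n] S = T := by
  induction n with
  | zero => exact ⟨T, hT, rfl⟩
  | succ n ih =>
    obtain ⟨S, hS, rfl⟩ := ih
    obtain ⟨W, hW, rfl⟩ := exists_preimage h hS
    exact ⟨W, hW, rfl⟩

end Limits

/-! ### Repetitivity and repulsion. -/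

section Recognizability

/-- Supertiles of every type contain the given one after the extra `n₀` substitutions supplied by
primitivity, so one level works for all types. -/
theorem exists_pow_supertile_subset (h : σ.IsPrimitive) {n : ℕ} {i : ι} {P : Set (ι × Eu d)}
    {v : Eu d} (hP : translate v P ⊆ σ.supertile n i) :
    ∃ m, ∀ j, ∃ w : Eu d, translate w P ⊆ σ.supertile m j := by
  obtain ⟨n₀, -, hprim⟩ := h
  refine ⟨n + n₀, fun j => ?_⟩
  obtain ⟨u, hu⟩ := hprim j i
  refine ⟨v + σ.factor ^ n • u, ?_⟩
  rw [← translate_translate]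
  refine (translate_mono hP).trans ?_
  rw [← iterate_singleton (σ := σ) n (i, u), supertile, Function.iterate_add_apply]
  exact iterate_mono n (singleton_subset_iff.2 hu)

/-- Repetitivity: the patches of a given radius recur within a bounded distance. -/
theorem exists_repetitivity_radius [Finite ι] (h : σ.IsPrimitive) (hflc : σ.HasFLC) {C : ℝ}
    (hC : 0 < C) : ∃ L > 0, ∀ U V, σ.Admissible U → σ.Admissible V →
      ∃ x : Eu d, ‖x‖ ≤ L ∧ σ.Agree (translate x V) U (Metric.ball x C) := by
  obtain ⟨Q, hQ, hflc⟩ := hflc C hC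
  obtain ⟨D, hD0, hD⟩ := σ.exists_diam_bound
  have key : ∀ P : Set (ι × Eu d), ∃ m : ℕ, ∀ V v, σ.Admissible V →
      σ.touching V (Metric.closedBall 0 C) = translate v P →
      ∀ j, ∃ w : Eu d, translate w P ⊆ σ.supertile m j := by
    intro P
    by_cases hP : ∃ V v, σ.Admissible V ∧ σ.touching V (Metric.closedBall 0 C) = translate v P
    · obtain ⟨V, v, hV, hVP⟩ := hP
      obtain ⟨n, i, w, hw⟩ := hV.2 (translate v P) (hVP ▸ fun p hp => hp.1)
        (hVP ▸ NonOverlapping.finite_touching hV.1.2 0 C)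
      rw [translate_translate] at hw
      obtain ⟨m, hm⟩ := exists_pow_supertile_subset h hw
      exact ⟨m, fun _ _ _ _ => hm⟩
    -- The value `0` is a default for patterns that never occur.
    · exact ⟨0, fun V v hV hVP => (hP ⟨V, v, hV, hVP⟩).elim⟩
  choose m hm using key
  obtain ⟨M, hM⟩ := (hQ.image m).bddAbove
  -- The pattern is found in the supertile of level at most `M` over the origin, whose diameter is
  -- at most `λ^M D`.
  refine ⟨σ.factor ^ M * D, mul_pos (factor_pow_pos M) hD0, fun U V hU hV => ?_⟩
  obtain ⟨P, hPQ, v, hv⟩ := hflc V hV 0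
  obtain ⟨U', hU', rfl⟩ := exists_iterate_preimage h (m P) hU
  obtain ⟨⟨j, u⟩, hju, h0⟩ := hU'.1.exists_mem 0
  obtain ⟨w, hw⟩ := hm P V v hV hv j
  set x : Eu d := -v + (w + σ.factor ^ m P • u)
  have hx : translate x (σ.touching V (Metric.closedBall 0 C)) ⊆ σ.apply^[m P] {(j, u)} := by
    rw [hv, translate_translate, show v + x = w + σ.factor ^ m P • u by simp [x],
      iterate_singleton, ← translate_translate]
    exact translate_mono hw
  have hagree : ∀ p ∈ translate x V, (σ.supp p ∩ Metric.ball x C).Nonempty →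
      p ∈ σ.apply^[m P] {(j, u)} := by
    rintro p hp ⟨y, hy, hyx⟩
    refine hx (mem_translate.2 ⟨mem_translate.1 hp, y - x, ?_, ?_⟩)
    · rw [mem_supp] at hy ⊢
      simpa using hy
    · rw [mem_closedBall_zero_iff, ← dist_eq_norm]
      exact (Metric.mem_ball.1 hyx).le
  refine ⟨x, ?_, fun p hp hpx =>
    iterate_mono _ (singleton_subset_iff.2 hju) (hagree p hp hpx)⟩
  obtain ⟨p, hp, hxp⟩ := (hV.1.translate x).exists_mem x
  obtain ⟨z, hz, hxz⟩ := exists_smul_of_mem_iterate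
    (hagree p hp ⟨x, hxp, Metric.mem_ball_self hC⟩) hxp
  rw [hxz, norm_smul, Real.norm_of_nonneg (factor_pow_pos _).le]
  have hz' := hD _ z hz 0 h0
  rw [sub_zero] at hz'
  exact mul_le_mul (pow_le_pow_right₀ σ.one_lt_factor.le (hM (mem_image_of_mem m hPQ))) hz'
    (norm_nonneg _) (factor_pow_pos _).le

theorem agree_inter_translate {S T : Set (ι × Eu d)} {x y : Eu d} {R : ℝ}
    (h : σ.Agree S T (Metric.ball x R)) {p : ι × Eu d} (hp : (p.1, p.2 + y) ∈ S) {z : Eu d}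
    (hz : z ∈ σ.supp p) (hzx : ‖z + y - x‖ < R) : (p.1, p.2 + y) ∈ T :=
  h _ hp ⟨z + y, mem_supp_add.2 (by simpa using hz), by
    rwa [Metric.mem_ball, dist_eq_norm]⟩

/-- A patch of radius `R` of an aperiodic tiling does not agree with itself after a nonzero shift
that is short compared to `R`. -/
theorem exists_repulsion_const [Finite ι] (h : σ.IsPrimitive) (hflc : σ.HasFLC)
    (hnp : σ.NonPeriodic) : ∃ c > 0, ∀ T, σ.Admissible T → ∀ (y : Eu d) (R : ℝ), 0 < R →
      σ.Agree T (translate y T) (Metric.ball 0 R) → ‖y‖ ≤ c * R → y = 0 := by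
  obtain ⟨r, hr, hball⟩ := σ.exists_inner_radius
  -- After `n` substitutions a patch of radius `λ r` grows to radius `λ^(n+1) r`, which will exceed
  -- `‖y‖`.
  have hC : 0 < σ.factor * r := mul_pos σ.factor_pos hr
  obtain ⟨L, hL, hrep⟩ := exists_repetitivity_radius h hflc hC
  have hLC : 0 < L + σ.factor * r := add_pos hL hC
  refine ⟨r / (L + σ.factor * r), div_pos hr hLC, fun T hT y R hR hagree hy => ?_⟩
  by_contra hy0
  -- A shorter nonzero shift would make a tile overlap its own translate.
  have hry : r ≤ ‖y‖ := by
    by_contra! hlt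
    obtain ⟨p, hp, h0⟩ := hT.1.exists_mem 0
    have hp' := mem_translate.1 (hagree p hp ⟨0, h0, Metric.mem_ball_self hR⟩)
    obtain ⟨c, hc⟩ := hball p
    have hne : p ≠ (p.1, p.2 - y) := fun he =>
      hy0 (sub_eq_self.1 (congrArg Prod.snd he).symm)
    have hd := Set.disjoint_left.1 (hT.1.2 p hp _ hp' hne)
    refine @hd (c - y) (hc ?_) ?_
    · simpa [dist_eq_norm] using hlt
    · rw [mem_interior_supp]
      have := hc (Metric.mem_ball_self hr)
      rw [mem_interior_supp] at this
      simpa using this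
  -- The scale of the shift: `λ^n r ≤ ‖y‖ < λ^(n+1) r`. With the chosen constant, the region of
  -- radius `λ^n (L + λ r)` lies inside the ball of agreement.
  obtain ⟨n, hn, hn'⟩ := exists_nat_pow_near ((one_le_div hr).2 hry) σ.one_lt_factor
  rw [le_div_iff₀ hr] at hn
  rw [div_lt_iff₀ hr] at hn'
  obtain ⟨U, hU, rfl⟩ := exists_iterate_preimage h n hT
  have hnpos := factor_pow_pos (σ := σ) n
  have hRn : σ.factor ^ n * (L + σ.factor * r) ≤ R := by
    rw [div_mul_eq_mul_div, le_div_iff₀ hLC] at hy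
    refine le_of_mul_le_mul_left ?_ hr
    calc r * (σ.factor ^ n * (L + σ.factor * r)) = (σ.factor ^ n * r) * (L + σ.factor * r) := by
          ring
      _ ≤ ‖y‖ * (L + σ.factor * r) := by gcongr
      _ ≤ r * R := hy
  -- Local agreement spreads to a global period: the patch around any tile `q` recurs near the
  -- origin (`h1`), is shifted there by `-y` (`h2`), and is carried back (`h4`), so `q - y` is a
  -- tile of `T`.
  refine hy0 (hnp _ hT y (eq_of_subset (fun q hq => ?_) hT.1 (hT.1.translate y)).symm)
  obtain ⟨p, hp, hqp⟩ := mem_iterate_iff.1 hq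
  obtain ⟨z, hz⟩ := supp_nonempty (σ := σ) q
  obtain ⟨x₀, hx₀, rfl⟩ := exists_smul_of_mem_iterate hqp hz
  obtain ⟨x, hx, hxU⟩ := hrep U (translate (-x₀) U) hU (hU.translate _)
  rw [translate_translate] at hxU
  have hS := hxU.iterate n
  rw [iterate_translate] at hS
  set s := σ.factor ^ n • (-x₀ + x)
  set T := σ.apply^[n] U
  have hsx : σ.factor ^ n • x₀ + s = σ.factor ^ n • x := by simp [s, smul_add]
  have hxn : ‖σ.factor ^ n • x‖ ≤ σ.factor ^ n * L := by
    rw [norm_smul, Real.norm_of_nonneg hnpos.le]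
    gcongr
  have hpos : 0 < σ.factor ^ n * (σ.factor * r) := mul_pos hnpos hC
  have h1 : (q.1, q.2 + s) ∈ T := by
    refine agree_inter_translate hS (mem_translate.2 (by simpa using hq)) hz ?_
    simpa [hsx] using hpos
  have h2 : (q.1, q.2 + s) ∈ translate y T := by
    refine agree_inter_translate hagree h1 hz ?_
    rw [sub_zero, hsx]
    linarith
  rw [mem_translate] at h2 ⊢
  have h3 := hS.symm Metric.isOpen_ball (hT.1.translate s) hT.1
  have h4 : (q.1, q.2 + (s - y)) ∈ translate s T := by
    refine agree_inter_translate h3 (by rwa [← add_sub_assoc]) hz ?_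
    rw [← add_sub_assoc, hsx, show σ.factor ^ n • x - y - σ.factor ^ n • x = -y by abel, norm_neg]
    calc ‖y‖ < σ.factor ^ (n + 1) * r := hn'
      _ = _ := by ring
  rw [mem_translate] at h4
  simpa only [add_sub_assoc, sub_sub_cancel_left, ← sub_eq_add_neg] using h4

end Recognizability

/-! ### Unique composition. -/

section Injectivity

open Filter

/-- Pigeonhole gives an infinite set of indices with the same `P n`; on it `v` is bounded and has a
Cauchy subsequence. -/
theorem exists_lt_eq_and_norm_sub_lt {α E : Type*} [NormedAddCommGroup E] [ProperSpace E]
    {Q : Set α} (hQ : Q.Finite) {P : ℕ → α} (hP : ∀ n, P n ∈ Q) {v : ℕ → E} {B : α → ℝ}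
    (hv : ∀ n, ‖v n‖ ≤ B (P n)) {δ : ℝ} (hδ : 0 < δ) :
    ∃ n m, n < m ∧ P n = P m ∧ ‖v m - v n‖ < δ := by
  have := hQ.to_subtype
  obtain ⟨q, hq⟩ := Finite.exists_infinite_fiber fun n => (⟨P n, hP n⟩ : Q)
  obtain ⟨φ, hφ, hφq⟩ := extraction_of_frequently_atTop
    (Nat.frequently_atTop_iff_infinite.2 (Set.infinite_coe_iff.1 hq))
  have hφq' : ∀ n, P (φ n) = q.1 := fun n => congrArg Subtype.val (hφq n)
  obtain ⟨a, -, ψ, hψ, ha⟩ := tendsto_subseq_of_bounded (x := v ∘ φ)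
    (Metric.isBounded_closedBall (x := (0 : E)) (r := B q.1))
    (fun n => mem_closedBall_zero_iff.2 (hφq' n ▸ hv (φ n)))
  obtain ⟨N, hN⟩ := Metric.cauchySeq_iff.1 ha.cauchySeq δ hδ
  refine ⟨φ (ψ N), φ (ψ (N + 1)), hφ (hψ N.lt_succ_self), by rw [hφq', hφq'], ?_⟩
  rw [← dist_eq_norm]
  exact hN _ N.le_succ _ le_rfl

theorem exists_translation_bound (P : Set (ι × Eu d)) :
    ∃ B : ℝ, ∀ S v, σ.IsTiling S → σ.touching S (Metric.closedBall 0 1) = translate v P →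
      ‖v‖ ≤ B := by
  rcases P.eq_empty_or_nonempty with rfl | ⟨e, he⟩
  · refine ⟨0, fun S v hS h => ?_⟩
    obtain ⟨p, hp, h0⟩ := hS.exists_mem 0
    have : p ∈ σ.touching S (Metric.closedBall 0 1) :=
      ⟨hp, 0, h0, Metric.mem_closedBall_self zero_le_one⟩
    rw [h, mem_translate] at this
    exact this.elim
  · obtain ⟨B, hB⟩ := (isCompact_supp (σ := σ) e).isBounded.exists_norm_le
    refine ⟨1 + B, fun S v _ h => ?_⟩
    have : (e.1, e.2 + v) ∈ σ.touching S (Metric.closedBall 0 1) := by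
      rw [h, mem_translate]
      simpa using he
    obtain ⟨-, y, hy, hy1⟩ := this
    have h1 := hB _ (mem_supp_add.1 hy)
    rw [mem_closedBall_zero_iff] at hy1
    have h2 := norm_sub_le y (y - v)
    rw [sub_sub_cancel] at h2
    linarith

theorem agree_of_touching_eq {S S' : Set (ι × Eu d)} {P : Set (ι × Eu d)} {v v' : Eu d}
    (h : σ.touching S (Metric.closedBall 0 1) = translate v P)
    (h' : σ.touching S' (Metric.closedBall 0 1) = translate v' P) (hv : ‖v' - v‖ ≤ 1 / 2) :
    σ.Agree (translate (v' - v) S) S' (Metric.ball 0 (1 / 2)) := by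
  rintro p hp ⟨y, hy, hy0⟩
  rw [mem_translate] at hp
  have hmem : (p.1, p.2 - (v' - v)) ∈ σ.touching S (Metric.closedBall 0 1) := by
    refine ⟨hp, y - (v' - v), ?_, ?_⟩
    · rw [mem_supp] at hy ⊢
      simpa using hy
    · rw [mem_ball_zero_iff] at hy0
      rw [mem_closedBall_zero_iff]
      linarith [norm_sub_le y (v' - v)]
  rw [h, mem_translate] at hmem
  have : p ∈ σ.touching S' (Metric.closedBall 0 1) := by
    rw [h', mem_translate]
    simpa only [sub_sub, sub_add_cancel] using hmem
  exact this.1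

/-- Unique composition (recognizability): an admissible tiling of a non-periodic primitive
substitution with finite local complexity is the substitution of only one admissible tiling. -/
theorem apply_injOn [Finite ι] (h : σ.IsPrimitive) (hflc : σ.HasFLC) (hnp : σ.NonPeriodic)
    {S S' : Set (ι × Eu d)} (hS : σ.Admissible S) (hS' : σ.Admissible S')
    (heq : σ.apply S = σ.apply S') : S = S' := by
  refine eq_of_subset (fun p hp => ?_) hS.1 hS'.1
  obtain ⟨x, hx⟩ := supp_nonempty (σ := σ) p
  have hpx : (p.1, p.2 + -x) ∈ translate (-x) S := mem_translate.2 (by simpa using hp)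
  have h0 : (0 : Eu d) ∈ σ.supp (p.1, p.2 + -x) := mem_supp_add.2 (by simpa using hx)
  suffices (p.1, p.2 + -x) ∈ translate (-x) S' by simpa [mem_translate] using this
  replace heq : σ.apply (translate (-x) S) = σ.apply (translate (-x) S') := by
    rw [apply_translate, apply_translate, heq]
  replace hS := hS.translate (-x)
  replace hS' := hS'.translate (-x)
  generalize translate (-x) S = S at *
  generalize translate (-x) S' = S' at *
  generalize (p.1, p.2 + -x) = p at *
  choose A hA hAS using fun n => exists_iterate_preimage h n hS
  choose A' hA' hAS' using fun n => exists_iterate_preimage h n hS'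
  obtain ⟨c, hc, hrepel⟩ := exists_repulsion_const h hflc hnp
  obtain ⟨Q, hQ, hflc⟩ := hflc 1 one_pos
  choose P hPQ v hv using fun n => hflc (A n) (hA n) 0
  choose P' hPQ' v' hv' using fun n => hflc (A' n) (hA' n) 0
  choose B hB using exists_translation_bound (σ := σ)
  -- Two shifts below `δ` differ by at most `1/4` and `c/4`. Scaled by `λ^(m+1)`, these are `ρ/2`
  -- and `c (ρ/2)`, as needed for repulsion on radius `ρ/2`.
  have hδ : 0 < min (1 / 8) (c / 8) := by positivity
  obtain ⟨n, m, hnm, hPnm, hvnm⟩ := exists_lt_eq_and_norm_sub_lt (hQ.prod hQ)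
    (P := fun n => (P n, P' n)) (fun n => ⟨hPQ n, hPQ' n⟩) (v := fun n => (v n, v' n))
    (B := fun P => max (B P.1) (B P.2))
    (fun n => max_le_max (hB _ _ _ (hA n).1 (hv n)) (hB _ _ _ (hA' n).1 (hv' n))) hδ
  obtain ⟨hP, hP'⟩ := Prod.ext_iff.1 hPnm
  dsimp only at hP hP'
  obtain ⟨hv1, hv2⟩ := max_lt_iff.1 hvnm
  change ‖v m - v n‖ < _ at hv1
  change ‖v' m - v' n‖ < _ at hv2
  obtain ⟨hv1, hv1c⟩ := lt_min_iff.1 hv1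
  obtain ⟨hv2, hv2c⟩ := lt_min_iff.1 hv2
  have hag : σ.Agree (translate (v m - v n) (A n)) (A m) (Metric.ball 0 (1 / 2)) :=
    agree_of_touching_eq (hP ▸ hv n) (hv m) (by linarith)
  have hag' : σ.Agree (translate (v' m - v' n) (A' n)) (A' m) (Metric.ball 0 (1 / 2)) :=
    agree_of_touching_eq (hP' ▸ hv' n) (hv' m) (by linarith)
  -- The two tilings have the same image after `n + 1` substitutions.
  have himg : ∀ k, n < k → ∀ w, σ.apply^[k] (translate w (A n)) =
      σ.apply^[k] (translate w (A' n)) := by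
    intro k hk w
    obtain ⟨l, rfl⟩ : ∃ l, k = l + (n + 1) := ⟨k - (n + 1), by omega⟩
    rw [iterate_translate, iterate_translate, Function.iterate_add_apply _ l (n + 1) (A n),
      Function.iterate_add_apply _ l (n + 1) (A' n), Function.iterate_succ_apply',
      Function.iterate_succ_apply', hAS, hAS', heq]
  have himgm : σ.apply^[m + 1] (A m) = σ.apply^[m + 1] (A' m) := by
    rw [Function.iterate_succ_apply', Function.iterate_succ_apply', hAS, hAS', heq]
  set u := v m - v n
  set u' := v' m - v' n
  -- After `m + 1` substitutions the primed and unprimed tilings coincide. If `u ≠ u'`, the tiling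
  -- `T` would agree with a short nonzero shift of itself.
  have huu : u = u' := by
    have h1 := hag.iterate_zero_ball (m + 1)
    have h2 := hag'.iterate_zero_ball (m + 1)
    rw [← himgm, ← himg _ (by omega), iterate_translate] at h2
    rw [iterate_translate] at h1
    set T := σ.apply^[m + 1] (A m)
    set W := σ.apply^[m + 1] (A n)
    set ρ := σ.factor ^ (m + 1) * (1 / 2)
    set s := σ.factor ^ (m + 1) • u
    set s' := σ.factor ^ (m + 1) • u'
    have hT : σ.Admissible T := (hA m).iterate _
    have hW : σ.Admissible W := (hA n).iterate _
    have hlam := factor_pow_pos (σ := σ) (m + 1)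
    have hρ : 0 < ρ := by positivity
    have hss : ‖s' - s‖ = σ.factor ^ (m + 1) * ‖u' - u‖ := by
      rw [← smul_sub, norm_smul, Real.norm_of_nonneg hlam.le]
    have hu1 : ‖u' - u‖ ≤ 1 / 4 := (norm_sub_le _ _).trans (by linarith)
    have hu2 : ‖u' - u‖ ≤ c / 4 := (norm_sub_le _ _).trans (by linarith)
    have h3 := (h1.symm Metric.isOpen_ball (hW.translate _).1 hT.1).translate (s' - s)
    rw [translate_translate, add_sub_cancel, zero_add] at h3
    have hsub : Metric.ball (0 : Eu d) (ρ / 2) ⊆ Metric.ball (s' - s) ρ := by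
      refine Metric.ball_subset_ball' ?_
      rw [dist_zero_left, hss]
      have := mul_le_mul_of_nonneg_left hu1 hlam.le
      simp only [ρ]
      linarith
    have h4 : σ.Agree (translate (s' - s) T) T (Metric.ball 0 (ρ / 2)) :=
      (h3.mono hsub).trans (h2.mono (Metric.ball_subset_ball (by linarith)))
    have h5 := hrepel T hT (s' - s) (ρ / 2) (by positivity)
      (h4.symm Metric.isOpen_ball (hT.translate _).1 hT.1) (by
        rw [hss]
        have := mul_le_mul_of_nonneg_left hu2 hlam.le
        simp only [ρ]
        linarith)
    rw [← norm_eq_zero, hss, mul_eq_zero, norm_eq_zero, sub_eq_zero] at h5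
    exact (h5.resolve_left hlam.ne').symm
  have hpos : (0 : ℝ) < σ.factor ^ m * (1 / 2) := mul_pos (factor_pow_pos m) (by norm_num)
  -- With equal shifts, apply `σ^m`. Since `n < m`, it identifies `A n` with `A' n`, yet sends `A m`
  -- to `S` and `A' m` to `S'`; so `S` and `S'` agree near the origin.
  have h1 := (hag.symm Metric.isOpen_ball ((hA n).translate _).1 (hA m).1).iterate_zero_ball m
  have h2 := hag'.iterate_zero_ball m
  rw [← huu, ← himg m hnm, hAS'] at h2
  rw [hAS] at h1
  exact (h1.trans h2) p hpx ⟨0, h0, Metric.mem_ball_self hpos⟩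

theorem iterate_injOn [Finite ι] (h : σ.IsPrimitive) (hflc : σ.HasFLC) (hnp : σ.NonPeriodic)
    (n : ℕ) {S S' : Set (ι × Eu d)} (hS : σ.Admissible S) (hS' : σ.Admissible S')
    (heq : σ.apply^[n] S = σ.apply^[n] S') : S = S' := by
  induction n with
  | zero => exact heq
  | succ n ih =>
    rw [Function.iterate_succ_apply', Function.iterate_succ_apply'] at heq
    exact ih (apply_injOn h hflc hnp (hS.iterate n) (hS'.iterate n) heq)

/-- Recognizability in local form: a large patch of `σ^n(S)` around the origin determines a patch
of `S`. -/
theorem exists_recognizability_radius [Finite ι] (h : σ.IsPrimitive) (hflc : σ.HasFLC)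
    (hnp : σ.NonPeriodic) (n : ℕ) {S : Set (ι × Eu d)} (hS : σ.Admissible S) (r : ℝ) :
    ∃ R : ℝ, ∀ S', σ.Admissible S' →
      σ.Agree (σ.apply^[n] S') (σ.apply^[n] S) (Metric.ball 0 R) →
      σ.Agree S' S (Metric.ball 0 r) := by
  induction n generalizing S r with
  | zero => exact ⟨r, fun S' _ h => h⟩
  | succ n ih =>
    obtain ⟨r', hr'⟩ : ∃ R : ℝ, ∀ S', σ.Admissible S' →
        σ.Agree (σ.apply S') (σ.apply S) (Metric.ball 0 R) → σ.Agree S' S (Metric.ball 0 r) := by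
      -- A limit of counterexamples is a preimage of `σ(S)`, hence is `S` itself, yet it agrees with
      -- one of the counterexamples on the ball.
      by_contra! hcon
      choose A hA hAS hAr using fun j : ℕ => hcon j
      obtain ⟨W, hW, hWS, hWA⟩ := exists_preimage_limit hS.apply hA hAS
      obtain rfl := apply_injOn h hflc hnp hW hS hWS
      obtain ⟨j, hj⟩ := hWA r
      exact hAr j (hj.symm Metric.isOpen_ball hW.1 (hA j).1)
    obtain ⟨R, hR⟩ := ih hS.apply r'
    exact ⟨R, fun S' hS' hag => hr' S' hS' (hR _ hS'.apply hag)⟩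

end Injectivity

end Substitution

/-! ### Generic segments and sets of codimension two. -/

section AffineSpan

variable {E : Type*} [NormedAddCommGroup E] [NormedSpace ℝ E]

theorem intrinsicInterior_subset_of_affineSpan_eq {s t : Set E} (hst : s ⊆ t)
    (h : affineSpan ℝ s = affineSpan ℝ t) : intrinsicInterior ℝ s ⊆ intrinsicInterior ℝ t := by
  unfold intrinsicInterior
  rw [← h]
  exact image_mono (interior_mono (preimage_mono hst))

/-- Two convex sets of codimension one with disjoint relative interiors meet in codimension at
least two. -/
theorem affineSpan_insert_inter_ne_top [FiniteDimensional ℝ E] [Nontrivial E] {F G : Set E}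
    (hF : Convex ℝ F) (hG : Convex ℝ G)
    (hFd : Module.finrank ℝ (vectorSpan ℝ F) + 1 = Module.finrank ℝ E)
    (hGd : Module.finrank ℝ (vectorSpan ℝ G) + 1 = Module.finrank ℝ E)
    (hd : Disjoint (intrinsicInterior ℝ F) (intrinsicInterior ℝ G)) (a : E) :
    affineSpan ℝ (insert a (F ∩ G)) ≠ ⊤ := by
  intro htop
  rw [AffineSubspace.affineSpan_eq_top_iff_vectorSpan_eq_top_of_nontrivial] at htop
  have hle := finrank_vectorSpan_insert_le_set ℝ (F ∩ G) a
  rw [htop, finrank_top] at hle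
  -- If adding `a` gave full span, then `F ∩ G` would have codimension at most one, hence the same
  -- affine span as `F` and `G`, and its relative interior would lie in both.
  have key : ∀ {F' : Set E}, F ∩ G ⊆ F' → (F ∩ G).Nonempty →
      Module.finrank ℝ (vectorSpan ℝ F') + 1 = Module.finrank ℝ E →
      affineSpan ℝ (F ∩ G) = affineSpan ℝ F' := by
    intro F' hsub hne hdim
    refine AffineSubspace.eq_of_direction_eq_of_nonempty_of_le ?_
      (hne.affineSpan ℝ) (affineSpan_mono ℝ hsub)
    rw [direction_affineSpan, direction_affineSpan]
    exact Submodule.eq_of_le_of_finrank_le (vectorSpan_mono ℝ hsub) (by omega)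
  rcases (F ∩ G).eq_empty_or_nonempty with he | hne
  · rw [he, insert_empty_eq, vectorSpan_singleton] at htop
    exact bot_ne_top htop
  · obtain ⟨x, hx⟩ := hne.intrinsicInterior (hF.inter hG)
    exact Set.disjoint_left.1 hd
      (intrinsicInterior_subset_of_affineSpan_eq inter_subset_left
        (key inter_subset_left hne hFd) hx)
      (intrinsicInterior_subset_of_affineSpan_eq inter_subset_right
        (key inter_subset_right hne hGd) hx)

open MeasureTheory in
theorem exists_mem_forall_notMem_affineSubspace [FiniteDimensional ℝ E]
    {A : Set (AffineSubspace ℝ E)} (hA : A.Finite) (hne : ∀ s ∈ A, s ≠ ⊤) {V : Set E}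
    (hV : IsOpen V) (hVne : V.Nonempty) : ∃ x ∈ V, ∀ s ∈ A, x ∉ s := by
  borelize E
  by_contra! hcon
  have h0 : (Measure.addHaar : Measure E) (⋃ s ∈ A, (s : Set E)) = 0 :=
    (measure_biUnion_null_iff hA.countable).2 fun s hs =>
      Measure.addHaar_affineSubspace _ s (hne s hs)
  refine (hV.measure_pos Measure.addHaar hVne).ne' (measure_mono_null (fun x hx => ?_) h0)
  obtain ⟨s, hs, hxs⟩ := hcon x hx
  exact mem_iUnion₂.2 ⟨s, hs, hxs⟩

/-- A point of the segment in the span of `H` differs from `a`, and the line from `a` through it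
would put `b` into the span of `a` and `H`. -/
theorem segment_disjoint_affineSpan {H : Set E} {a b : E} (ha : a ∉ affineSpan ℝ H)
    (hb : b ∉ affineSpan ℝ (insert a H)) {y : E} (hy : y ∈ segment ℝ a b) :
    y ∉ affineSpan ℝ H := by
  intro hyH
  rw [segment_eq_image_lineMap] at hy
  obtain ⟨t, -, rfl⟩ := hy
  have ht : t ≠ 0 := by
    rintro rfl
    rw [AffineMap.lineMap_apply_zero] at hyH
    exact ha hyH
  refine hb ?_
  have h1 : a ∈ affineSpan ℝ (insert a H) := subset_affineSpan ℝ _ (mem_insert _ _)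
  have h2 := affineSpan_mono ℝ (subset_insert a H) hyH
  have h3 := AffineMap.lineMap_mem t⁻¹ h1 h2
  have h4 : AffineMap.lineMap a (AffineMap.lineMap a b t) t⁻¹ = b := by
    simp [AffineMap.lineMap_apply, smul_smul, ht]
  rwa [h4] at h3

end AffineSpan

namespace Substitution

variable {d : ℕ} {ι : Type*} {σ : Substitution d ι}

/-! ### The tiles around the origin. -/

section Star

theorem isClosed_of_mem_placedFacets {p : ι × Eu d} {F : Set (Eu d)}
    (hF : F ∈ σ.placedFacets p) : IsClosed F := by
  obtain ⟨F₀, hF₀, rfl⟩ := hF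
  obtain ⟨s, rfl, -⟩ := (σ.tile p.1).facet_convex F₀ hF₀
  exact (Homeomorph.addRight p.2).isClosedMap _
    (s.finite_toSet.isCompact_convexHull ℝ).isClosed

open Pointwise in
theorem convex_of_mem_placedFacets {p : ι × Eu d} {F : Set (Eu d)}
    (hF : F ∈ σ.placedFacets p) :
    Convex ℝ F ∧ Module.finrank ℝ (vectorSpan ℝ F) + 1 = d := by
  obtain ⟨F₀, hF₀, rfl⟩ := hF
  obtain ⟨s, rfl, hs⟩ := (σ.tile p.1).facet_convex F₀ hF₀
  have h : (fun x => x + p.2) '' convexHull ℝ (s : Set (Eu d)) =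
      p.2 +ᵥ convexHull ℝ (s : Set (Eu d)) := by
    simp only [← image_vadd, vadd_eq_add, add_comm]
  have hspan : vectorSpan ℝ ((fun x => x + p.2) '' convexHull ℝ (s : Set (Eu d))) =
      vectorSpan ℝ (s : Set (Eu d)) := by
    rw [h, vectorSpan_vadd, ← direction_affineSpan, affineSpan_convexHull, direction_affineSpan]
  refine ⟨?_, by rw [hspan]; exact hs⟩
  dsimp only
  rw [h]
  exact (convex_convexHull ℝ _).vadd _

theorem finite_placedFacets (p : ι × Eu d) : (σ.placedFacets p).Finite :=
  (σ.tile p.1).finite_facets.image _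

theorem frontier_supp (p : ι × Eu d) : frontier (σ.supp p) = ⋃₀ σ.placedFacets p := by
  rw [supp_eq_image, ← Homeomorph.image_frontier, (σ.tile p.1).frontier_eq, sUnion_eq_biUnion,
    image_iUnion₂, placedFacets, sUnion_image]
  rfl

/-- The point of the Anderson–Putnam complex that a placed tile assigns to the origin. -/
def originIn (σ : Substitution d ι) (p : ι × Eu d) (h : (0 : Eu d) ∈ σ.supp p) : σ.APComplex :=
  σ.toAP ⟨p.1, -p.2, by simpa [mem_supp] using h⟩

theorem originIn_eq_of_facet {T : Set (ι × Eu d)} (hT : σ.Admissible T) {p q : ι × Eu d}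
    (hp : p ∈ T) (hq : q ∈ T) (hp0 : (0 : Eu d) ∈ σ.supp p) (hq0 : (0 : Eu d) ∈ σ.supp q)
    {F : Set (Eu d)} (hFp : F ∈ σ.placedFacets p) (hFq : F ∈ σ.placedFacets q)
    (hF0 : (0 : Eu d) ∈ F) : σ.originIn p hp0 = σ.originIn q hq0 := by
  obtain ⟨F₁, hF₁, he₁⟩ := hFp
  obtain ⟨F₂, hF₂, he₂⟩ := hFq
  have hmem : ∀ {v : Eu d} {F' : Set (Eu d)}, (fun x => x + v) '' F' = F → -v ∈ F' := by
    intro v F' he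
    rw [← he] at hF0
    obtain ⟨x, hx, hx0⟩ := hF0
    rwa [← eq_neg_of_add_eq_zero_left hx0]
  exact Quot.sound ⟨T, p.2, q.2, hT, hp, hq, F₁, hF₁, F₂, hF₂, he₁.trans he₂.symm,
    hmem he₁, hmem he₂, by simp⟩

/-- All tiles of an admissible tiling that contain the origin assign the same point of the
Anderson–Putnam complex to it. -/
theorem originIn_eq [Finite ι] (hd : 0 < d) (hface : σ.MeetsFaceToFace) {T : Set (ι × Eu d)}
    (hT : σ.Admissible T) {p q : ι × Eu d} (hp : p ∈ T) (hq : q ∈ T)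
    (hp0 : (0 : Eu d) ∈ σ.supp p) (hq0 : (0 : Eu d) ∈ σ.supp q) :
    σ.originIn p hp0 = σ.originIn q hq0 := by
  by_contra hne
  have : Nonempty (Fin d) := ⟨⟨0, hd⟩⟩
  set N : Set (ι × Eu d) := {s ∈ T | (0 : Eu d) ∈ σ.supp s}
  have hN : N.Finite := (NonOverlapping.finite_touching hT.1.2 0 1).subset fun s hs =>
    ⟨hs.1, 0, hs.2, Metric.mem_closedBall_self zero_le_one⟩
  -- `A` collects the tiles at the origin that give the same point as `p`, and `B` the others. A
  -- segment from `p` to `q` must pass from `A` to `B`; the aim is that this happens on a glued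
  -- facet.
  set A : Set (ι × Eu d) := {s ∈ N | ∃ h, σ.originIn s h = σ.originIn p hp0}
  set B : Set (ι × Eu d) := {s ∈ N | ∃ h, σ.originIn s h ≠ σ.originIn p hp0}
  have hcl : ∀ C ⊆ N, IsClosed (⋃ s ∈ C, σ.supp s) := fun C hC =>
    (hN.subset hC).isClosed_biUnion fun s _ => isClosed_supp s
  set Φ : Set (Set (Eu d)) := ⋃ s ∈ N, σ.placedFacets s
  have hΦ : Φ.Finite := hN.biUnion fun s _ => finite_placedFacets s
  have hΦcl : ∀ F ∈ Φ, IsClosed F := by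
    intro F hF
    obtain ⟨s, -, hF⟩ := mem_iUnion₂.1 hF
    exact isClosed_of_mem_placedFacets hF
  -- A ball around the origin that only the tiles and facets through the origin meet.
  obtain ⟨r, hr, hrT, hrΦ⟩ : ∃ r > 0, (∀ s ∈ T, (σ.supp s ∩ Metric.ball 0 r).Nonempty → s ∈ N) ∧
      ∀ F ∈ Φ, (F ∩ Metric.ball 0 r).Nonempty → (0 : Eu d) ∈ F := by
    obtain ⟨r₁, hr₁, h₁⟩ := NonOverlapping.exists_thickening hT.1.2
      (isCompact_singleton (x := (0 : Eu d)))
    have hopen : IsOpen (⋃ F ∈ {F ∈ Φ | (0 : Eu d) ∉ F}, F)ᶜ :=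
      ((hΦ.subset (sep_subset _ _)).isClosed_biUnion fun F hF => hΦcl F hF.1).isOpen_compl
    have h0mem : (0 : Eu d) ∈ (⋃ F ∈ {F ∈ Φ | (0 : Eu d) ∉ F}, F)ᶜ := fun h => by
      obtain ⟨F, hF, h⟩ := mem_iUnion₂.1 h
      exact hF.2 h
    obtain ⟨r₂, hr₂, h₂⟩ := Metric.isOpen_iff.1 hopen 0 h0mem
    refine ⟨min r₁ r₂, lt_min hr₁ hr₂, fun s hs hsr => ?_, fun F hF ⟨y, hy, hyr⟩ => ?_⟩
    · obtain ⟨x, hx, rfl⟩ := h₁ s hs (by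
        rw [Metric.thickening_singleton]
        exact hsr.mono (inter_subset_inter_right _ (Metric.ball_subset_ball (min_le_left _ _))))
      exact ⟨hs, hx⟩
    · by_contra h
      exact h₂ (Metric.ball_subset_ball (min_le_right _ _) hyr) (mem_iUnion₂.2 ⟨F, ⟨hF, h⟩, hy⟩)
  -- The pairs of facets whose intersection has codimension at least two and is to be avoided.
  set Ψ : Set (Set (Eu d) × Set (Eu d)) :=
    {x ∈ Φ ×ˢ Φ | Disjoint (intrinsicInterior ℝ x.1) (intrinsicInterior ℝ x.2)}
  have hΨ : Ψ.Finite := (hΦ.prod hΦ).subset (sep_subset _ _)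
  have hspan : ∀ x ∈ Ψ, ∀ a, affineSpan ℝ (insert a (x.1 ∩ x.2)) ≠ ⊤ := by
    rintro ⟨F, G⟩ ⟨⟨hF, hG⟩, hdis⟩ a
    obtain ⟨s, -, hF⟩ := mem_iUnion₂.1 hF
    obtain ⟨s', -, hG⟩ := mem_iUnion₂.1 hG
    obtain ⟨hF1, hF2⟩ := convex_of_mem_placedFacets hF
    obtain ⟨hG1, hG2⟩ := convex_of_mem_placedFacets hG
    exact affineSpan_insert_inter_ne_top hF1 hG1 (by simpa using hF2) (by simpa using hG2) hdis a
  have hopen : ∀ s : ι × Eu d, (0 : Eu d) ∈ σ.supp s →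
      (interior (σ.supp s) ∩ Metric.ball 0 r).Nonempty := fun s h =>
    inter_interior_supp_nonempty Metric.isOpen_ball ⟨0, h, Metric.mem_ball_self hr⟩
  -- A generic segment from one tile to the other.
  obtain ⟨a, ⟨hap, har⟩, ha⟩ := exists_mem_forall_notMem_affineSubspace
    (hΨ.image fun x => affineSpan ℝ (x.1 ∩ x.2)) (by
      rintro _ ⟨x, hx, rfl⟩ htop
      have := affineSpan_mono ℝ (subset_insert (0 : Eu d) (x.1 ∩ x.2))
      exact hspan x hx 0 (top_le_iff.1 (htop ▸ this)))
    (isOpen_interior.inter Metric.isOpen_ball) (hopen p hp0)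
  obtain ⟨b, ⟨hbq, hbr⟩, hb⟩ := exists_mem_forall_notMem_affineSubspace
    (hΨ.image fun x => affineSpan ℝ (insert a (x.1 ∩ x.2)))
    (by rintro _ ⟨x, hx, rfl⟩; exact hspan x hx a)
    (isOpen_interior.inter Metric.isOpen_ball) (hopen q hq0)
  have hseg : segment ℝ a b ⊆ Metric.ball 0 r := (convex_ball 0 r).segment_subset har hbr
  have hcover : segment ℝ a b ⊆ (⋃ s ∈ A, σ.supp s) ∪ ⋃ s ∈ B, σ.supp s := by
    intro y hy
    obtain ⟨s, hs, hys⟩ := hT.1.exists_mem y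
    have hsN := hrT s hs ⟨y, hys, hseg hy⟩
    by_cases h : σ.originIn s hsN.2 = σ.originIn p hp0
    · exact Or.inl (mem_iUnion₂.2 ⟨s, ⟨hsN, _, h⟩, hys⟩)
    · exact Or.inr (mem_iUnion₂.2 ⟨s, ⟨hsN, _, h⟩, hys⟩)
  obtain ⟨y, hy, hyA, hyB⟩ := isPreconnected_closed_iff.1 (convex_segment a b).isPreconnected _ _
    (hcl A (sep_subset _ _)) (hcl B (sep_subset _ _)) hcover
    ⟨a, left_mem_segment ℝ a b, mem_iUnion₂.2 ⟨p, ⟨⟨hp, hp0⟩, hp0, rfl⟩, interior_subset hap⟩⟩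
    ⟨b, right_mem_segment ℝ a b,
      mem_iUnion₂.2 ⟨q, ⟨⟨hq, hq0⟩, hq0, fun h => hne h.symm⟩, interior_subset hbq⟩⟩
  obtain ⟨s, ⟨hsN, hs0, hsA⟩, hys⟩ := mem_iUnion₂.1 hyA
  obtain ⟨s', ⟨hsN', hs0', hsB⟩, hys'⟩ := mem_iUnion₂.1 hyB
  have hss : s ≠ s' := by
    rintro rfl
    exact hsB hsA
  have hfr : y ∈ frontier (σ.supp s) := by
    rw [(isClosed_supp s).frontier_eq]
    exact ⟨hys, fun h => hss (NonOverlapping.eq_of_mem_interior hT.1.2 hsN'.1 hsN.1 hys' h).symm⟩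
  have hfr' : y ∈ frontier (σ.supp s') := by
    rw [(isClosed_supp s').frontier_eq]
    exact ⟨hys', fun h => hss (NonOverlapping.eq_of_mem_interior hT.1.2 hsN.1 hsN'.1 hys h)⟩
  rw [frontier_supp] at hfr hfr'
  obtain ⟨F, hF, hyF⟩ := hfr
  obtain ⟨G, hG, hyG⟩ := hfr'
  have hFΦ : F ∈ Φ := mem_iUnion₂.2 ⟨s, hsN, hF⟩
  have hGΦ : G ∈ Φ := mem_iUnion₂.2 ⟨s', hsN', hG⟩
  -- Equal facets contain the origin by the choice of `r` and glue `s` to `s'`; non-overlapping ones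
  -- are excluded by genericity of the segment.
  rcases hface T hT s hsN.1 s' hsN'.1 hss F hF G hG with rfl | hdis
  · refine hsB ?_
    rw [← hsA]
    exact (originIn_eq_of_facet hT hsN.1 hsN'.1 hs0 hs0' hF hG
      (hrΦ F hFΦ ⟨y, hyF, hseg hy⟩)).symm
  · have hmem : (F, G) ∈ Ψ := ⟨⟨hFΦ, hGΦ⟩, hdis⟩
    exact segment_disjoint_affineSpan (ha _ (mem_image_of_mem _ hmem))
      (hb _ (mem_image_of_mem _ hmem)) hy (subset_affineSpan ℝ _ ⟨hyF, hyG⟩)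

end Star

/-! ### The position of the origin in a tiling. -/

section Origin

/-- The point of the Anderson–Putnam complex at which the origin lies in a tiling. -/
def origin (σ : Substitution d ι) (T : Set (ι × Eu d)) (hT : σ.IsTiling T) : σ.APComplex :=
  σ.originIn (hT.exists_mem 0).choose (hT.exists_mem 0).choose_spec.2

theorem origin_eq [Finite ι] (hd : 0 < d) (hface : σ.MeetsFaceToFace) {T : Set (ι × Eu d)}
    (hT : σ.Admissible T) {p : ι × Eu d} (hp : p ∈ T) (hp0 : (0 : Eu d) ∈ σ.supp p) :
    σ.origin T hT.1 = σ.originIn p hp0 :=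
  originIn_eq hd hface hT (hT.1.exists_mem 0).choose_spec.1 hp _ hp0

theorem origin_congr [Finite ι] (hd : 0 < d) (hface : σ.MeetsFaceToFace) {T T' : Set (ι × Eu d)}
    (hT : σ.Admissible T) (hT' : σ.Admissible T') {r : ℝ} (hr : 0 < r)
    (h : σ.Agree T T' (Metric.ball 0 r)) : σ.origin T hT.1 = σ.origin T' hT'.1 := by
  obtain ⟨p, hp, hp0⟩ := hT.1.exists_mem 0
  rw [origin_eq hd hface hT hp hp0,
    origin_eq hd hface hT' (h p hp ⟨0, hp0, Metric.mem_ball_self hr⟩) hp0]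

theorem zero_mem_supp_neg (a : σ.PrototilePoint) : (0 : Eu d) ∈ σ.supp (a.1, -a.2.1) := by
  simp [mem_supp]

theorem originIn_neg (a : σ.PrototilePoint) (h : (0 : Eu d) ∈ σ.supp (a.1, -a.2.1)) :
    σ.originIn (a.1, -a.2.1) h = σ.toAP a := by
  obtain ⟨i, x, hx⟩ := a
  simp [originIn]

theorem origin_eq_toAP [Finite ι] (hd : 0 < d) (hface : σ.MeetsFaceToFace)
    {T : Set (ι × Eu d)} (hT : σ.Admissible T) {a : σ.PrototilePoint} (ha : (a.1, -a.2.1) ∈ T) :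
    σ.origin T hT.1 = σ.toAP a := by
  rw [origin_eq hd hface hT ha (zero_mem_supp_neg a), originIn_neg]

theorem exists_prototilePoint (T : Set (ι × Eu d)) (hT : σ.IsTiling T) :
    ∃ a : σ.PrototilePoint, (a.1, -a.2.1) ∈ T := by
  obtain ⟨p, hp, hp0⟩ := hT.exists_mem 0
  exact ⟨⟨p.1, -p.2, by simpa [mem_supp] using hp0⟩, by simpa using hp⟩

theorem exists_origin_eq [Finite ι] (hd : 0 < d) (h : σ.IsPrimitive) (hface : σ.MeetsFaceToFace)
    (z : σ.APComplex) : ∃ (T : Set (ι × Eu d)) (hT : σ.Admissible T), σ.origin T hT.1 = z := by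
  obtain ⟨a, rfl⟩ : ∃ a, σ.toAP a = z := Quot.exists_rep z
  obtain ⟨T, hT, ha⟩ := exists_admissible_mem h a.1 (-a.2.1)
  exact ⟨T, hT, origin_eq_toAP hd hface hT ha⟩

/-- Moving the common point to the origin replaces gluing by two tiles of one tiling, so a function
on prototile points that is computed from tilings descends to the complex. -/
theorem Glued.exists_tiling {a b : σ.PrototilePoint} (h : σ.Glued a b) :
    ∃ T, σ.Admissible T ∧ (a.1, -a.2.1) ∈ T ∧ (b.1, -b.2.1) ∈ T := by
  obtain ⟨T, u, v, hT, ha, hb, F, -, G, -, -, -, -, he⟩ := h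
  refine ⟨translate (-(a.2.1 + u)) T, hT.translate _, mem_translate.2 ?_, mem_translate.2 ?_⟩
  · simpa using ha
  · rw [he]
    simpa using hb

end Origin

/-! ### The induced map on the complex. -/

section InducedMap

theorem smul_zero_mem {p : ι × Eu d} (h : (0 : Eu d) ∈ σ.supp p) :
    ∃ q ∈ σ.apply {p}, (0 : Eu d) ∈ σ.supp q := by
  simpa only [smul_zero] using exists_mem_apply h

/-- The image of a point is the position of the origin in `σ(T)`, for any `T` whose tile puts the
origin at that point. By `originIn_eq` the choice of `T` is immaterial, and glued points share a
`T`. -/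
theorem exists_isInducedMap [Finite ι] (hd : 0 < d) (h : σ.IsPrimitive)
    (hface : σ.MeetsFaceToFace) : ∃ f, σ.IsInducedMap f := by
  choose A hA hmem using fun a : σ.PrototilePoint => exists_admissible_mem h a.1 (-a.2.1)
  have key : ∀ a T, (hT : σ.Admissible T) → (a.1, -a.2.1) ∈ T →
      σ.origin (σ.apply (A a)) (hA a).apply.1 = σ.origin (σ.apply T) hT.apply.1 := by
    intro a T hT haT
    obtain ⟨q, hq, hq0⟩ := smul_zero_mem (zero_mem_supp_neg a)
    rw [origin_eq hd hface (hA a).apply (mem_apply_iff.2 ⟨_, hmem a, hq⟩) hq0,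
      origin_eq hd hface hT.apply (mem_apply_iff.2 ⟨_, haT, hq⟩) hq0]
  refine ⟨Quot.lift (fun a => σ.origin (σ.apply (A a)) (hA a).apply.1) fun a b hab => ?_,
    fun a b w hw he => ?_⟩
  · obtain ⟨T, hT, ha, hb⟩ := hab.exists_tiling
    exact (key a T hT ha).trans (key b T hT hb).symm
  · refine origin_eq_toAP hd hface (hA a).apply ⟨_, hmem a, (b.1, w), hw, ?_⟩
    simp [he]

/-- Each prototile is a finite union of closed pieces, one per tile of its subdivision, and on each
piece the map is affine followed by the projection. -/
theorem IsInducedMap.continuous {f : σ.APComplex → σ.APComplex} (hf : σ.IsInducedMap f) :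
    Continuous f := by
  have hquot : Continuous (fun a : σ.PrototilePoint => f (σ.toAP a)) := by
    refine continuous_sigma fun i => ?_
    let C : σ.rule i → Set (σ.tile i).carrier := fun r =>
      {x | σ.factor • x.1 - r.1.2 ∈ (σ.tile r.1.1).carrier}
    refine LocallyFinite.continuous (f := C) (locallyFinite_of_finite _)
      (eq_univ_of_forall fun x => ?_) (fun r => ?_) fun r => ?_
    · have hx : σ.factor • x.1 ∈ (fun x => σ.factor • x) '' (σ.tile i).carrier := ⟨x.1, x.2, rfl⟩
      rw [← σ.rule_cover i] at hx
      obtain ⟨r, hr, hx⟩ := mem_iUnion₂.1 hx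
      exact mem_iUnion.2 ⟨⟨r, hr⟩, mem_supp.1 hx⟩
    · exact (σ.tile r.1.1).isCompact.isClosed.preimage (by fun_prop)
    · rw [continuousOn_iff_continuous_domRestrict]
      have he : (C r).domRestrict (fun x => f (σ.toAP ⟨i, x⟩)) =
          fun x => σ.toAP ⟨r.1.1, ⟨σ.factor • x.1.1 - r.1.2, x.2⟩⟩ := by
        funext x
        exact hf ⟨i, x.1⟩ ⟨r.1.1, ⟨_, x.2⟩⟩ r.1.2 r.2 (by simp)
      rw [he]
      refine continuous_quot_mk.comp (continuous_sigmaMk.comp (Continuous.subtype_mk ?_ _))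
      fun_prop
  exact isQuotientMap_quot_mk.continuous_iff.2 hquot

theorem IsInducedMap.origin [Finite ι] {f : σ.APComplex → σ.APComplex} (hf : σ.IsInducedMap f)
    (hd : 0 < d) (hface : σ.MeetsFaceToFace) {T : Set (ι × Eu d)} (hT : σ.Admissible T) :
    f (σ.origin T hT.1) = σ.origin (σ.apply T) hT.apply.1 := by
  obtain ⟨a, ha⟩ := exists_prototilePoint T hT.1
  obtain ⟨q, ⟨p, hp, r, hr, rfl⟩, hq0⟩ := smul_zero_mem (zero_mem_supp_neg a)
  obtain rfl : p = (a.1, -a.2.1) := hp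
  rw [origin_eq_toAP hd hface hT ha, origin_eq hd hface hT.apply ⟨_, ha, r, hr, rfl⟩ hq0]
  exact hf a ⟨r.1, _, _⟩ r.2 hr (by simp)

end InducedMap

/-! ### Consequences of forcing the border. -/

section Border

/-- If the substitution forces the border, a common tile forces a common patch around it after
`k` substitutions. -/
theorem ForcesBorderAt.exists_agree [Finite ι] (h : σ.IsPrimitive) {k : ℕ}
    (hk : σ.ForcesBorderAt k) : ∃ ε > 0, ∀ T T', σ.Admissible T → σ.Admissible T' →
      ∀ p ∈ T, p ∈ T' → ∀ x ∈ σ.supp p,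
        σ.Agree (σ.apply^[k] T) (σ.apply^[k] T') (Metric.ball (σ.factor ^ k • x) ε) := by
  -- One reference tiling per type suffices to find `ε`, since the surroundings of a supertile
  -- depend only on its type.
  choose A hA hmem using fun i => exists_admissible_mem h i 0
  have hcomp : ∀ i, IsCompact ((fun x => σ.factor ^ k • x) '' σ.supp (i, 0)) := fun i =>
    (isCompact_supp _).image (by fun_prop)
  choose δ hδ hthick using fun i => NonOverlapping.exists_thickening ((hA i).iterate k).1.2 (hcomp i)
  obtain ⟨ε, hε, hle⟩ := exists_pos_forall_le δ hδ
  refine ⟨ε, hε, ?_⟩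
  rintro T T' hT hT' ⟨i, u⟩ hp hp' x hx q hq hqx
  -- Near the supertile the reference tiling consists of tiles touching it; these belong to the
  -- surroundings and are therefore transferred to `T`.
  have hcov : ∀ z ∈ Metric.ball (σ.factor ^ k • x) ε,
      ∃ s ∈ σ.touching (σ.apply^[k] T) ((fun x => σ.factor ^ k • x) '' σ.supp (i, u)),
        z ∈ σ.supp s := by
    intro z hz
    obtain ⟨s, hs, hzs⟩ := ((hA i).iterate k).1.exists_mem (z - σ.factor ^ k • u)
    have hthk : z - σ.factor ^ k • u ∈
        Metric.thickening (δ i) ((fun x => σ.factor ^ k • x) '' σ.supp (i, 0)) := by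
      refine Metric.mem_thickening_iff.2 ⟨_, ⟨x - u, ?_, rfl⟩, ?_⟩
      · simpa [mem_supp] using hx
      · dsimp only
        rw [smul_sub, dist_sub_right]
        exact (Metric.mem_ball.1 hz).trans_le (hle i)
    have hsur : s ∈ σ.surroundings k (A i) i 0 := by
      rw [surroundings, smul_zero, neg_zero, translate_zero]
      exact ⟨hs, hthick i s hs ⟨_, hzs, hthk⟩⟩
    rw [hk (A i) T (hA i) hT i 0 u (hmem i) hp, surroundings, mem_translate, sub_neg_eq_add] at hsur
    exact ⟨_, hsur, mem_supp_add.2 hzs⟩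
  have hqN := NonOverlapping.mem_of_cover (hT.iterate k).1.2 (fun s hs => hs.1)
    Metric.isOpen_ball hcov hq hqx
  have hqs : (q.1, q.2 - σ.factor ^ k • u) ∈ σ.surroundings k T i u := by
    rw [surroundings, mem_translate]
    simpa using hqN
  rw [hk T T' hT hT' i u u hp hp', surroundings, mem_translate] at hqs
  simpa using hqs.1

/-- If the substitution forces the border, the point of the Anderson–Putnam complex at the origin
forces a patch around the origin after sufficiently many substitutions. -/
theorem ForcesBorder.exists_agree [Finite ι] (hd : 0 < d) (h : σ.IsPrimitive)
    (hface : σ.MeetsFaceToFace) (hb : σ.ForcesBorder) : ∃ m : ℕ, ∃ ε > 0, ∀ T T'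
      (hT : σ.Admissible T) (hT' : σ.Admissible T'), σ.origin T hT.1 = σ.origin T' hT'.1 →
        σ.Agree (σ.apply^[m] T) (σ.apply^[m] T') (Metric.ball 0 ε) := by
  obtain ⟨k, hk⟩ := hb
  obtain ⟨ε, hε, hag⟩ := hk.exists_agree h
  -- Equal points of the complex may be joined only by a chain of gluings, with no tile common to
  -- `T` and `T'`. The tiles of `σ^k(T)` at the origin are nevertheless constant along the chain.
  let star : σ.PrototilePoint → Set (ι × Eu d) := fun a =>
    {q | ∃ T, σ.Admissible T ∧ (a.1, -a.2.1) ∈ T ∧ q ∈ σ.apply^[k] T ∧ (0 : Eu d) ∈ σ.supp q}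
  have hstar : ∀ a T, σ.Admissible T → (a.1, -a.2.1) ∈ T →
      star a = {q ∈ σ.apply^[k] T | (0 : Eu d) ∈ σ.supp q} := by
    refine fun a T hT haT => Set.ext fun q =>
      ⟨fun ⟨T', hT', haT', hq, hq0⟩ => ⟨?_, hq0⟩, fun hq => ⟨T, hT, haT, hq⟩⟩
    exact hag T' T hT' hT _ haT' haT 0 (zero_mem_supp_neg a) q hq
      ⟨0, hq0, by simpa using hε⟩
  let star' : σ.APComplex → Set (ι × Eu d) := Quot.lift star fun a b hab => by
    obtain ⟨T, hT, ha, hb⟩ := hab.exists_tiling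
    rw [hstar a T hT ha, hstar b T hT hb]
  have hstar' : ∀ T (hT : σ.Admissible T),
      star' (σ.origin T hT.1) = {q ∈ σ.apply^[k] T | (0 : Eu d) ∈ σ.supp q} := fun T hT => by
    obtain ⟨a, ha⟩ := exists_prototilePoint T hT.1
    rw [origin_eq_toAP hd hface hT ha]
    exact hstar a T hT ha
  -- The first `k` substitutions yield a common tile at the origin, the next `k` a common ball
  -- around it.
  refine ⟨k + k, ε, hε, fun T T' hT hT' he => ?_⟩
  obtain ⟨q, hq, hq0⟩ := (hT.iterate k).1.exists_mem 0
  have hmem : q ∈ {q ∈ σ.apply^[k] T | (0 : Eu d) ∈ σ.supp q} := ⟨hq, hq0⟩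
  rw [← hstar' T hT, he, hstar' T' hT'] at hmem
  rw [Function.iterate_add_apply, Function.iterate_add_apply]
  simpa using hag _ _ (hT.iterate k) (hT'.iterate k) q hq hmem.1 0 hq0

end Border

/-! ### Continuity and openness of the coordinates. -/

section Topology

theorem Close.exists_agree {ε : ℝ} {T T' : Set (ι × Eu d)} (h : σ.Close ε T T') :
    ∃ w : Eu d, ‖w‖ < 2 * ε ∧ σ.Agree (translate w T') T (Metric.ball 0 (1 / ε - ε)) := by
  obtain ⟨u, v, hu, hv, he⟩ := h
  refine ⟨v - u, (norm_sub_le v u).trans_lt (by linarith), ?_⟩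
  rintro p hp ⟨y, hy, hyε⟩
  have hmem : (p.1, p.2 + u) ∈ σ.touching (translate v T') (Metric.closedBall 0 (1 / ε)) := by
    refine ⟨?_, y + u, mem_supp_add.2 (by simpa using hy), ?_⟩
    · rw [mem_translate] at hp ⊢
      simpa only [add_sub_assoc, sub_sub_eq_add_sub, ← sub_add] using hp
    · rw [mem_closedBall_zero_iff]
      rw [mem_ball_zero_iff] at hyε
      linarith [norm_add_le y u]
  rw [← he] at hmem
  simpa using mem_translate.1 hmem.1

theorem Agree.close {ε R : ℝ} {T T' : Set (ι × Eu d)} {w : Eu d} (hT : σ.IsTiling T)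
    (hT' : σ.IsTiling T') (h : σ.Agree (SubstitutionTiling.translate w T') T (Metric.ball 0 R)) (hε : 0 < ε)
    (hw : ‖w‖ < ε) (hR : 1 / ε < R) : σ.Close ε T T' := by
  have hsub : Metric.closedBall (0 : Eu d) (1 / ε) ⊆ Metric.ball 0 R :=
    Metric.closedBall_subset_ball hR
  refine ⟨0, w, by simpa using hε, hw, ?_⟩
  rw [translate_zero]
  exact Subset.antisymm
    (fun p hp => ⟨(h.symm Metric.isOpen_ball (hT'.translate w) hT) p hp.1
      (hp.2.mono (inter_subset_inter_right _ hsub)), hp.2⟩)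
    (fun p hp => ⟨h p hp.1 (hp.2.mono (inter_subset_inter_right _ hsub)), hp.2⟩)

/-- The point of the Anderson–Putnam complex at the origin varies continuously. -/
theorem exists_forall_agree_origin_mem [Finite ι] (hd : 0 < d) (hface : σ.MeetsFaceToFace)
    {S : Set (ι × Eu d)} (hS : σ.Admissible S) {O : Set σ.APComplex} (hO : IsOpen O)
    (hSO : σ.origin S hS.1 ∈ O) : ∃ δ > 0, ∀ S' (hS' : σ.Admissible S') (w : Eu d), ‖w‖ < δ →
      σ.Agree (translate w S') S (Metric.ball 0 δ) → σ.origin S' hS'.1 ∈ O := by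
  set N : Set (ι × Eu d) := {s ∈ S | (0 : Eu d) ∈ σ.supp s}
  have hN : N.Finite := (NonOverlapping.finite_touching hS.1.2 0 1).subset fun s hs =>
    ⟨hs.1, 0, hs.2, Metric.mem_closedBall_self zero_le_one⟩
  have hloc : ∀ s : N, ∃ δ > 0, ∀ x : (σ.tile s.1.1).carrier, dist x.1 (-s.1.2) < δ →
      σ.toAP ⟨s.1.1, x⟩ ∈ O := by
    rintro ⟨s, hs, hs0⟩
    have hcont : Continuous fun x : (σ.tile s.1).carrier => σ.toAP ⟨s.1, x⟩ :=
      continuous_quot_mk.comp continuous_sigmaMk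
    rw [origin_eq hd hface hS hs hs0] at hSO
    obtain ⟨δ, hδ, h⟩ := Metric.isOpen_iff.1 (hO.preimage hcont) ⟨-s.2, _⟩ hSO
    exact ⟨δ, hδ, fun x hx => h hx⟩
  choose δ hδ hδO using hloc
  have := hN.to_subtype
  obtain ⟨δ₀, hδ₀, hle⟩ := exists_pos_forall_le δ hδ
  obtain ⟨r, hr, hrS⟩ := NonOverlapping.exists_thickening hS.1.2
    (isCompact_singleton (x := (0 : Eu d)))
  rw [Metric.thickening_singleton] at hrS
  -- The bound `r` ensures that a tile of `S` containing `w` also contains the origin, so it is one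
  -- of the finitely many in `N`.
  refine ⟨min δ₀ r, lt_min hδ₀ hr, fun S' hS' w hw hag => ?_⟩
  obtain ⟨a, ha⟩ := exists_prototilePoint S' hS'.1
  rw [origin_eq_toAP hd hface hS' ha]
  have hwa : w ∈ σ.supp (a.1, -a.2.1 + w) := mem_supp_add.2 (by simp [mem_supp])
  have hmem : (a.1, -a.2.1 + w) ∈ S :=
    hag _ (mem_translate.2 (by simpa using ha)) ⟨w, hwa, mem_ball_zero_iff.2 hw⟩
  obtain ⟨x, hx, rfl⟩ :=
    hrS _ hmem ⟨w, hwa, mem_ball_zero_iff.2 (hw.trans_le (min_le_right _ _))⟩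
  have hwδ := hw.trans_le ((min_le_left _ _).trans (hle ⟨_, hmem, hx⟩))
  refine hδO ⟨_, hmem, hx⟩ a.2 (lt_of_eq_of_lt ?_ hwδ)
  simp [dist_eq_norm]

/-- Continuity of the `n`-th coordinate: by recognizability, closeness of the `n`-fold substitutions
passes to `S` and `S'`, with the shift divided by `λ^n`. -/
theorem exists_forall_close_origin_mem [Finite ι] (hd : 0 < d) (h : σ.IsPrimitive)
    (hflc : σ.HasFLC) (hnp : σ.NonPeriodic) (hface : σ.MeetsFaceToFace) (n : ℕ)
    {S : Set (ι × Eu d)} (hS : σ.Admissible S) {O : Set σ.APComplex} (hO : IsOpen O)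
    (hSO : σ.origin S hS.1 ∈ O) : ∃ ε > 0, ∀ S' (hS' : σ.Admissible S'),
      σ.Close ε (σ.apply^[n] S) (σ.apply^[n] S') → σ.origin S' hS'.1 ∈ O := by
  obtain ⟨δ, hδ, hδO⟩ := exists_forall_agree_origin_mem hd hface hS hO hSO
  obtain ⟨R, hR⟩ := exists_recognizability_radius h hflc hnp n hS δ
  have hlam := factor_pow_pos (σ := σ) n
  -- The resulting shift is below `2ε ≤ λ^n δ`, and the radius of agreement is `1/ε - ε ≥ R`.
  set ε := min (min 1 (σ.factor ^ n * δ / 2)) (1 / (|R| + 1))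
  have hε : 0 < ε := by positivity
  have hε1 : ε ≤ 1 := (min_le_left _ _).trans (min_le_left _ _)
  have hεδ : ε ≤ σ.factor ^ n * δ / 2 := (min_le_left _ _).trans (min_le_right _ _)
  have hεR : R ≤ 1 / ε - ε := by
    have h1 : |R| + 1 ≤ 1 / ε := (le_one_div (by positivity) hε).2 (min_le_right _ _)
    linarith [le_abs_self R]
  refine ⟨ε, hε, fun S' hS' hc => ?_⟩
  obtain ⟨w, hw, hag⟩ := hc.exists_agree
  refine hδO S' hS' ((σ.factor ^ n)⁻¹ • w) ?_ (hR _ (hS'.translate _) ?_)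
  · rw [norm_smul, norm_inv, Real.norm_of_nonneg hlam.le, inv_mul_lt_iff₀ hlam]
    linarith
  · rw [iterate_translate, smul_inv_smul₀ hlam.ne']
    exact hag.mono (Metric.ball_subset_ball hεR)

/-- If the substitution forces the border, nearby points of the Anderson–Putnam complex come from
tilings that are close after sufficiently many substitutions. -/
theorem exists_isOpen_forall_close [Finite ι] (hd : 0 < d) (h : σ.IsPrimitive)
    (hface : σ.MeetsFaceToFace) (hb : σ.ForcesBorder) {ε : ℝ} (hε : 0 < ε) :
    ∃ n : ℕ, ∀ S (hS : σ.Admissible S), ∃ O : Set σ.APComplex, IsOpen O ∧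
      σ.origin S hS.1 ∈ O ∧ ∀ S' (hS' : σ.Admissible S'), σ.origin S' hS'.1 ∈ O →
        σ.Close ε (σ.apply^[n] S) (σ.apply^[n] S') := by
  obtain ⟨m, ρ, hρ, hag⟩ := hb.exists_agree hd h hface
  -- The levels `m` and `N` do not depend on `S`, which is essential because `S` will be the
  -- preimage of level `N + m`.
  obtain ⟨N, hN⟩ := pow_unbounded_of_one_lt (1 / ε / (ρ / 2)) σ.one_lt_factor
  rw [div_lt_iff₀ (by positivity)] at hN
  have hm := factor_pow_pos (σ := σ) m
  have hn := factor_pow_pos (σ := σ) (N + m)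
  refine ⟨N + m, fun S hS => ?_⟩
  set δ := min (ρ / 2 / σ.factor ^ m) (ε / σ.factor ^ (N + m))
  have hδ : 0 < δ := by positivity
  have hδm : ∀ w : Eu d, ‖w‖ < δ → ‖σ.factor ^ m • w‖ < ρ / 2 := fun w hw => by
    rw [norm_smul, Real.norm_of_nonneg hm.le, mul_comm, ← lt_div_iff₀ hm]
    exact hw.trans_le (min_le_left _ _)
  let near : Set (ι × Eu d) → Eu d → Prop := fun T w =>
    σ.Agree (σ.apply^[m] (translate w T)) (σ.apply^[m] S) (Metric.ball 0 (ρ / 2))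
  have hnear : ∀ T T' (hT : σ.Admissible T) (hT' : σ.Admissible T'),
      σ.origin T hT.1 = σ.origin T' hT'.1 → ∀ w, ‖w‖ < δ → near T' w → near T w := by
    intro T T' hT hT' he w hw hT'w
    refine Agree.trans ?_ hT'w
    rw [iterate_translate, iterate_translate]
    refine ((hag T T' hT hT' he).translate (σ.factor ^ m • w)).mono (Metric.ball_subset_ball' ?_)
    rw [zero_add, dist_zero_left]
    linarith [hδm w hw]
  -- By `hnear`, being near `S` after a small shift depends only on the point at the origin. The set
  -- is open because moving that point inside a prototile only changes the shift.
  refine ⟨{z | ∃ (T : Set (ι × Eu d)) (hT : σ.Admissible T), σ.origin T hT.1 = z ∧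
    ∃ w, ‖w‖ < δ ∧ near T w}, ?_, ?_, ?_⟩
  · refine isQuotientMap_quot_mk.isOpen_preimage.1 (isOpen_sigma_iff.2 fun i => ?_)
    refine Metric.isOpen_iff.2 ?_
    rintro x ⟨T, hT, he, w, hw, hTw⟩
    refine ⟨δ - ‖w‖, by linarith, fun y hy => ?_⟩
    obtain ⟨T', hT', hxT'⟩ := exists_admissible_mem h i (-x.1)
    have hyT' : (i, -y.1) ∈ translate (x.1 - y.1) T' := by
      rwa [mem_translate, show -y.1 - (x.1 - y.1) = -x.1 by abel]
    refine ⟨_, hT'.translate _, origin_eq_toAP (a := ⟨i, y⟩) hd hface (hT'.translate _) hyT',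
      w + (y.1 - x.1), ?_, ?_⟩
    · rw [Metric.mem_ball, Subtype.dist_eq, dist_eq_norm] at hy
      linarith [norm_add_le w (y.1 - x.1)]
    · have hTT' : near T' w := hnear T' T hT' hT
        ((origin_eq_toAP (a := ⟨i, x⟩) hd hface hT' hxT').trans he.symm) w hw hTw
      simp only [near]
      rwa [translate_translate, show x.1 - y.1 + (w + (y.1 - x.1)) = w by abel]
  · refine ⟨S, hS, rfl, 0, by simpa using hδ, ?_⟩
    simp only [near]
    rw [translate_zero]
    exact fun p hp _ => hp
  · rintro S' hS' ⟨T, hT, he, w, hw, hTw⟩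
    have hS'w := (hnear S' T hS' hT he.symm w hw hTw).iterate_zero_ball N
    rw [← Function.iterate_add_apply, ← Function.iterate_add_apply, iterate_translate] at hS'w
    refine hS'w.close (hS.iterate _).1 (hS'.iterate _).1 hε ?_ hN
    rw [norm_smul, Real.norm_of_nonneg hn.le, mul_comm, ← lt_div_iff₀ hn]
    exact hw.trans_le (min_le_right _ _)

end Topology

/-! ### Tilings and coherent sequences. -/

section Correspondence

open Filter

theorem exists_pow_mul_ge {ε : ℝ} (hε : 0 < ε) (R : ℝ) : ∃ n : ℕ, R ≤ σ.factor ^ n * ε := by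
  obtain ⟨n, hn⟩ := pow_unbounded_of_one_lt (R / ε) σ.one_lt_factor
  exact ⟨n, ((div_lt_iff₀ hε).1 hn).le⟩

/-- A tiling is determined by the points of the Anderson–Putnam complex that its iterated
preimages assign to the origin. -/
theorem eq_of_forall_origin_eq [Finite ι] (hd : 0 < d) (h : σ.IsPrimitive)
    (hface : σ.MeetsFaceToFace) (hb : σ.ForcesBorder) {T T' : Set (ι × Eu d)}
    (hT : σ.Admissible T) (hT' : σ.Admissible T') {S S' : ℕ → Set (ι × Eu d)}
    (hS : ∀ n, σ.Admissible (S n)) (hS' : ∀ n, σ.Admissible (S' n))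
    (hST : ∀ n, σ.apply^[n] (S n) = T) (hST' : ∀ n, σ.apply^[n] (S' n) = T')
    (heq : ∀ n, σ.origin (S n) (hS n).1 = σ.origin (S' n) (hS' n).1) : T = T' := by
  obtain ⟨m, ε, hε, hag⟩ := hb.exists_agree hd h hface
  refine eq_of_agree_balls hT.1 hT'.1 fun R => ?_
  obtain ⟨n, hn⟩ := exists_pow_mul_ge (σ := σ) hε R
  refine ⟨_, hn, ?_⟩
  have := (hag _ _ (hS (n + m)) (hS' (n + m)) (heq _)).iterate_zero_ball n
  rwa [← Function.iterate_add_apply, ← Function.iterate_add_apply, hST, hST'] at this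

/-- Every coherent sequence of points of the Anderson–Putnam complex comes from a sequence of
successive preimages of a tiling. -/
theorem exists_forall_origin_eq [Finite ι] (hd : 0 < d) (h : σ.IsPrimitive)
    (hface : σ.MeetsFaceToFace) (hb : σ.ForcesBorder) {f : σ.APComplex → σ.APComplex}
    (hf : σ.IsInducedMap f) {x : ℕ → σ.APComplex} (hx : ∀ n, f (x (n + 1)) = x n) :
    ∃ (S : ℕ → Set (ι × Eu d)) (hS : ∀ n, σ.Admissible (S n)),
      (∀ n, σ.apply (S (n + 1)) = S n) ∧ ∀ n, σ.origin (S n) (hS n).1 = x n := by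
  obtain ⟨m, ε, hε, hag⟩ := hb.exists_agree hd h hface
  choose U hU hUx using fun n => exists_origin_eq hd h hface (x n)
  have horigin : ∀ j n, σ.origin (σ.apply^[j] (U (n + j))) ((hU (n + j)).iterate j).1 = x n := by
    intro j
    induction j with
    | zero => exact fun n => hUx n
    | succ j ih =>
      intro n
      have h1 := hf.origin hd hface ((hU (n + 1 + j)).iterate j)
      rw [ih, hx] at h1
      rw [h1]
      congr 1
      rw [← Function.iterate_succ_apply' σ.apply, show n + 1 + j = n + (j + 1) by omega]
  let W : ℕ → ℕ → Set (ι × Eu d) := fun n j => σ.apply^[j] (U (n + j))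
  have hW : ∀ n j, σ.Admissible (W n j) := fun n j => (hU _).iterate j
  -- Both `U (n+i+m)` and `σ^l(U (n+i+m+l))` have the origin at `x (n+i+m)`. Hence they agree on a
  -- ball after `m` substitutions, and `i` more enlarge it, so each sequence `W n` stabilizes on
  -- every ball.
  have hWag : ∀ n i l, σ.Agree (W n (i + m)) (W n (i + m + l))
      (Metric.ball 0 (σ.factor ^ i * ε)) := by
    intro n i l
    have he : W n (i + m + l) = σ.apply^[i + m] (σ.apply^[l] (U (n + (i + m) + l))) := by
      simp only [W, ← Function.iterate_add_apply, add_assoc]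
    have h1 := (hag _ _ (hU (n + (i + m))) ((hU (n + (i + m) + l)).iterate l)
      ((hUx _).trans (horigin l _).symm)).iterate_zero_ball i
    rw [← Function.iterate_add_apply, ← Function.iterate_add_apply, ← he] at h1
    exact h1
  let S : ℕ → Set (ι × Eu d) := fun n => {p | ∀ᶠ j in atTop, p ∈ W n j}
  have hev : ∀ n (ρ : ℝ), ∀ᶠ j in atTop, ∀ p, (σ.supp p ∩ Metric.ball 0 ρ).Nonempty →
      (p ∈ S n ↔ p ∈ W n j) := by
    intro n ρ
    obtain ⟨i, hi⟩ := exists_pow_mul_ge (σ := σ) hε ρ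
    have hiff : ∀ j ≥ i + m, ∀ p, (σ.supp p ∩ Metric.ball 0 ρ).Nonempty →
        (p ∈ W n (i + m) ↔ p ∈ W n j) := by
      intro j hj p hp
      obtain ⟨l, rfl⟩ := Nat.exists_eq_add_of_le hj
      have h1 := (hWag n i l).mono (Metric.ball_subset_ball hi)
      exact ⟨fun hpW => h1 p hpW hp,
        fun hpW => h1.symm Metric.isOpen_ball (hW _ _).1 (hW _ _).1 p hpW hp⟩
    filter_upwards [eventually_ge_atTop (i + m)] with j hj p hp
    rw [← hiff j hj p hp]
    refine ⟨fun hpS => ?_, fun hpW => ?_⟩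
    · obtain ⟨l, hl, hpl⟩ := ((eventually_ge_atTop (i + m)).and hpS).exists
      exact (hiff l hl p hp).2 hpl
    · filter_upwards [eventually_ge_atTop (i + m)] with l hl
      exact (hiff l hl p hp).1 hpW
  have hS : ∀ n, σ.Admissible (S n) := fun n => admissible_of_eventually (hW n) (hev n)
  refine ⟨S, hS, fun n => eq_of_subset (fun q hq => ?_) (hS _).apply.1 (hS n).1, fun n => ?_⟩
  · obtain ⟨p, hp, hqp⟩ := mem_apply_iff.1 hq
    change ∀ᶠ j in atTop, q ∈ W n j
    rw [← map_add_atTop_eq_nat 1, eventually_map]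
    filter_upwards [show ∀ᶠ j in atTop, p ∈ W (n + 1) j from hp] with j hj
    have he : W n (j + 1) = σ.apply (W (n + 1) j) := by
      simp only [W, Function.iterate_succ_apply', show n + 1 + j = n + (j + 1) by omega]
    rw [he]
    exact mem_apply_iff.2 ⟨p, hj, hqp⟩
  · obtain ⟨j, hj⟩ := (hev n 1).exists
    rw [← horigin j n]
    exact origin_congr hd hface (hS n) (hW n j) one_pos fun p hp hp1 => (hj p hp1).1 hp

end Correspondence

end Substitution

end SubstitutionTiling

end

/-! ### The homeomorphism. -/

theorem mainTheorem6 {d : ℕ} (hd : 0 < d) {ι : Type*} [Finite ι]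
    (σ : SubstitutionTiling.Substitution d ι)
    (h_primitive : σ.IsPrimitive) (h_nonperiodic : σ.NonPeriodic)
    (h_face : σ.MeetsFaceToFace) (h_flc : σ.HasFLC) (h_border : σ.ForcesBorder) :
    ∃ f : σ.APComplex → σ.APComplex, Continuous f ∧ σ.IsInducedMap f ∧
      Nonempty (σ.TilingSpace ≃ₜ
        SubstitutionTiling.InverseLimit (fun _ => σ.APComplex) (fun _ => f)) := by
  open SubstitutionTiling SubstitutionTiling.Substitution in
  obtain ⟨f, hf⟩ := exists_isInducedMap hd h_primitive h_face
  refine ⟨f, hf.continuous, hf, ?_⟩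
  choose pre hpre hpreT using fun (n : ℕ) (T : σ.TilingSpace) =>
    exists_iterate_preimage h_primitive n T.2
  -- Unique composition makes the independently chosen preimages coherent.
  have happly : ∀ n T, σ.apply (pre (n + 1) T) = pre n T := fun n T => by
    refine iterate_injOn h_primitive h_flc h_nonperiodic n (hpre _ T).apply (hpre n T) ?_
    rw [hpreT, ← Function.iterate_succ_apply, hpreT]
  let Ψ : σ.TilingSpace → InverseLimit (fun _ => σ.APComplex) (fun _ => f) := fun T =>
    ⟨fun n => σ.origin (pre n T) (hpre n T).1, fun n => by
      refine (hf.origin hd h_face (hpre (n + 1) T)).trans ?_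
      congr 1
      exact happly n T⟩
  have hbij : Function.Bijective Ψ := by
    constructor
    · intro T T' he
      exact Subtype.ext (eq_of_forall_origin_eq hd h_primitive h_face h_border T.2 T'.2
        (fun n => hpre n T) (fun n => hpre n T') (fun n => hpreT n T) (fun n => hpreT n T')
        fun n => congrFun (congrArg Subtype.val he) n)
    · rintro ⟨x, hx⟩
      obtain ⟨S, hS, happ, hSx⟩ :=
        exists_forall_origin_eq hd h_primitive h_face h_border hf hx
      have hiter : ∀ n, σ.apply^[n] (S n) = S 0 := fun n => by
        induction n with
        | zero => rfl
        | succ n ih => rw [Function.iterate_succ_apply, happ, ih]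
      refine ⟨⟨S 0, hS 0⟩, Subtype.ext (funext fun n => ?_)⟩
      refine Eq.trans ?_ (hSx n)
      have he : pre n ⟨S 0, hS 0⟩ = S n := iterate_injOn h_primitive h_flc h_nonperiodic n
        (hpre n _) (hS n) ((hpreT n _).trans (hiter n).symm)
      change σ.origin (pre n ⟨S 0, hS 0⟩) (hpre n _).1 = σ.origin (S n) (hS n).1
      congr 1
  refine ⟨(Equiv.ofBijective Ψ hbij).toHomeomorphOfContinuousOpen ?_ ?_⟩
  · refine continuous_induced_rng.2 (continuous_pi fun n => continuous_def.2 fun O hO T hT => ?_)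
    obtain ⟨ε, hε, h⟩ := exists_forall_close_origin_mem hd h_primitive h_flc h_nonperiodic h_face
      n (hpre n T) hO hT
    refine ⟨ε, hε, fun T' hTT' => h (pre n T') (hpre n T') ?_⟩
    rwa [hpreT, hpreT]
  · intro U hU
    refine isOpen_iff_forall_mem_open.2 ?_
    rintro _ ⟨T, hTU, rfl⟩
    obtain ⟨ε, hε, h⟩ := hU T hTU
    -- One coordinate, taken far enough along, controls the tiling up to `ε`, so the image of `U`
    -- contains a cylinder set around each of its points.
    obtain ⟨n, hn⟩ := exists_isOpen_forall_close hd h_primitive h_face h_border hε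
    obtain ⟨O, hO, hTO, hclose⟩ := hn (pre n T) (hpre n T)
    refine ⟨{y | y.1 n ∈ O}, ?_, hO.preimage ((continuous_apply n).comp continuous_subtype_val),
      hTO⟩
    intro y hy
    obtain ⟨T', rfl⟩ := hbij.2 y
    refine ⟨T', h T' ?_, rfl⟩
    have := hclose (pre n T') (hpre n T') hy
    rwa [hpreT, hpreT] at this
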